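/- **Setting.** Let $\lambda_-<\lambda_+$ and let $f:\mathbb R\times\mathbb R\to\mathbb R$ be $C^\infty$, bounded on $\mathbb R\times[\lambda_-,\lambda_+]$, such that for every $\lambda\in[\lambda_-,\lambda_+]$, except at most finitely many $\lambda\in(\lambda_-,\lambda_+)$, all equilibria of $\dot x=f(x,\lambda)$ are hyperbolic. A *curve of quasi-static equilibria* is a continuous $X:[\lambda_-,\lambda_+]\to\mathbb R$ with $f(X(\lambda),\lambda)=0\neq\partial_xf(X(\lambda),\lambda)$ for all $\lambda$. Let $X^s,X^u$ be two such curves with $\partial_xf(X^s(\lambda),\lambda)<0$ for all $\lambda$, $\partial_xf(X^u(\lambda_+),\lambda_+)>0$, $X^u<X^s$, and no equilibrium of $f(\cdot,\lambda)$ in $(X^u(\lambda),X^s(\lambda))$ for any $\lambda\in[\lambda_-,\lambda_+]$. Let $d_0>0$ be such that $\min_\lambda|X(\lambda)-Y(\lambda)|>d_0$ for any two distinct curves $X,Y$ of quasi-static equilibria. Fix an integer $n\ge 0$. Let $\Lambda\in C^{\max(2,n+1)}(\mathbb R)$ be strictly increasing with $\Lambda(t)\to\lambda_\pm$ and $\Lambda^{(k)}(t)\to0$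 ($1\le k\le n+1$) as $t\to\pm\infty$. For $r>0$ consider $$\dot x=f(x,\Lambda(rt)),\qquad(1)$$ and let $x(t,t_0,x_0)$ be the solution with value $x_0$ at $t_0$ (all solutions are global). Let $x^r_-$ be the solution of (1) with $x^r_-(t)\to X^s(\lambda_-)$ as $t\to-\infty$, and $x^r_+$ the solution with $x^r_+(t)\to X^u(\lambda_+)$ as $t\to\infty$. We say that $x^r_-$ *end-point tracks* $X^s$ if $x^r_-(t)\to X^s(\lambda_+)$ as $t\to\infty$. For $X\in\{X^s,X^u\}$ define $a_0(\tau)=X(\Lambda(\tau))$ and, for $i\ge1$, $$a_i=\frac1{\partial_xf}\Big[\dot a_{i-1}-\sum_{j=2}^{i}\frac{\partial_x^jf}{j!}\sum_{k_1+\dots+k_j=i,\;k_l\ge1}a_{k_1}\cdots a_{k_j}\Big],$$ where the derivatives of $f$ are evaluated at $(a_0(\tau),\Lambda(\tau))$. Put $S_n(r,t)=\sum_{i=0}^na_i(rt)r^i$, written $S^s_n$ for $X=X^s$ and $S^u_n$ for $X=X^u$. Let $\widetilde r>0$ and $\varepsilon\in(0,d_0/2)$ be such that for every $0<r\le\widetilde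 r$, $x^r_-$ is locally pullback attracting on $(-\infty,0]$ with a radius larger than $\varepsilon$ and $x^r_+$ is locally pullback repelling on $[0,\infty)$ with a radius larger than $\varepsilon$. That is, there is $\delta>\varepsilon$ such that $|x^r_-(t)-x(t,s,\xi(s))|\to0$ as $s\to-\infty$ for all $t\le0$, whenever $|\xi(s)-x^r_-(s)|<\delta$ for all $s\le0$; and there is $\delta>\varepsilon$ such that $|x^r_+(t)-x(t,s,\xi(s))|\to0$ as $s\to\infty$ for all $t\ge0$, whenever $|\xi(s)-x^r_+(s)|<\delta$ for all $s\ge0$. Define $$D_{out}(\tau,r)=x\big(0,-\tau,S^s_n(r,-\tau)+\varepsilon\big)-x\big(0,\tau,S^u_n(r,\tau)-\varepsilon\big),$$ $$D_{in}(\tau,r)=x\big(0,-\tau,S^s_n(r,-\tau)-\varepsilon\big)-x\big(0,\tau,S^u_n(r,\tau)+\varepsilon\big).$$ **Theorem.** There is $\overline r\in(0,\widetilde r)$ such that $D_{out}(\tau,r)>0$ and $D_{in}(\tau,r)>0$ for all $0<r<\overline r$ and $\tau\ge0$. Moreover, for every $r^*\in(0,\widetilde r)$: 1. The following are equivalent.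 * (a) $x^r_-$ and $x^r_+$ collide in a rate-induced tipping at $r^*$: $x^{r^*}_-=x^{r^*}_+$, and $x^r_-$ end-point tracks $X^s$ for all $r<r^*$ sufficiently close to $r^*$. * (b) $r^*>\overline r$, and there is $\tau_{in}\ge0$ such that for every $\tau>\tau_{in}$ there is a largest $\delta=\delta(n,\tau)\in(0,r^*]$ with $D_{in}(\tau,r)<0$ for all $r\in(r^*-\delta,r^*]$; $\delta(n,\tau)$ is nonincreasing in $\tau>\tau_{in}$ and $\lim_{\tau\to\infty}\delta(n,\tau)=0$; and for each $r<r^*$ sufficiently close to $r^*$, $D_{in}(\tau,r)>0$ for all sufficiently large $\tau$. 2. The following are equivalent. * (c) $x^{r^*}_-=x^{r^*}_+$ and there is $\delta>0$ such that $x^r_-(0)\ge x^r_+(0)$ for all $r\in(r^*-\delta,r^*)$ and $x^r_-(0)<x^r_+(0)$ for all $r\in(r^*,r^*+\delta)$. * (d) $r^*>\overline r$, and there are $\delta>0$ and $\tau_0\ge0$ such that $D_{out}(\tau,r)>0$ for all $r\in(r^*-\delta,r^*]$ and $\tau>\tau_0$, while for every $r\in(r^*,r^*+\delta)$ there is $\tau_{out}=\tau_{out}(r)>0$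 with $D_{out}(\tau,r)<0$ for all $\tau>\tau_{out}$. 3. If $x^r_-\ne x^r_+$ for all $r\neq r^*$ sufficiently close to $r^*$, then (d) implies that $x^r_-$ and $x^r_+$ collide in a *visible rate-induced tipping* at $r^*$: there is $\delta>0$ such that for $r\in(r^*-\delta,r^*)$, $x^r_-$ end-point tracks $X^s$ and $x^r_->x^r_+$ on $\mathbb R$; $x^{r^*}_-=x^{r^*}_+$; and for $r\in(r^*,r^*+\delta)$, $x^r_-<x^r_+$ on $\mathbb R$. -/

import Mathlib

open Set Filter Topology
open scoped Nat ContDiff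

noncomputable section

/-- The data of the problem `x' = f (x, Λ (r t))`: the vector field `f x l`, the drift `Lam` of the
parameter, its past and future limits `lm` and `lp`, and two families of quasi-static equilibria. -/
structure RateProblem where
  f : ℝ → ℝ → ℝ
  Lam : ℝ → ℝ
  lm : ℝ
  lp : ℝ
  Xs : ℝ → ℝ
  Xu : ℝ → ℝ

namespace RateProblem

/-- The partial derivative of `f` with respect to `x`. -/
def dfx (P : RateProblem) (x l : ℝ) : ℝ := deriv (fun y => P.f y l) x

/-- A curve of quasi-static equilibria: a continuous family, over the whole parameter interval, of
hyperbolic fixed points of `x' = f (x, l)`. -/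
def IsEquilibriumCurve (P : RateProblem) (X : ℝ → ℝ) : Prop :=
  ContinuousOn X (Icc P.lm P.lp) ∧
    ∀ l ∈ Icc P.lm P.lp, P.f (X l) l = 0 ∧ P.dfx (X l) l ≠ 0

/-- The basic assumptions on the vector field, the drift, and the family of stable equilibria. -/
structure H0 (P : RateProblem) : Prop where
  contDiff_f : ContDiff ℝ 2 (Function.uncurry P.f)
  bounded_f : ∃ M : ℝ, ∀ x : ℝ, ∀ l ∈ Icc P.lm P.lp, |P.f x l| ≤ M
  hyperbolic_lm : ∀ x : ℝ, P.f x P.lm = 0 → P.dfx x P.lm ≠ 0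
  hyperbolic_lp : ∀ x : ℝ, P.f x P.lp = 0 → P.dfx x P.lp ≠ 0
  finite_nonhyperbolic : {l ∈ Ioo P.lm P.lp | ∃ x : ℝ, P.f x l = 0 ∧ P.dfx x l = 0}.Finite
  curve_Xs : P.IsEquilibriumCurve P.Xs
  stable_Xs : ∀ l ∈ Icc P.lm P.lp, P.dfx (P.Xs l) l < 0
  contDiff_Lam : ContDiff ℝ 2 P.Lam
  strictMono_Lam : StrictMono P.Lam
  tendsto_Lam_atBot : Tendsto P.Lam atBot (𝓝 P.lm)
  tendsto_Lam_atTop : Tendsto P.Lam atTop (𝓝 P.lp)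
  tendsto_deriv_Lam_atBot : Tendsto (deriv P.Lam) atBot (𝓝 0)
  tendsto_deriv_Lam_atTop : Tendsto (deriv P.Lam) atTop (𝓝 0)

/-- The assumptions on the family of unstable equilibria, which lies below the stable one, and on
the separation constant `d0`. -/
structure H1 (P : RateProblem) (d0 : ℝ) : Prop where
  curve_Xu : P.IsEquilibriumCurve P.Xu
  unstable_Xu : 0 < P.dfx (P.Xu P.lp) P.lp
  Xu_lt_Xs : ∀ l ∈ Icc P.lm P.lp, P.Xu l < P.Xs l
  no_equilibria_between :
    ∀ l ∈ Icc P.lm P.lp, ∀ x ∈ Ioo (P.Xu l) (P.Xs l), P.f x l ≠ 0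
  d0_pos : 0 < d0
  separated : ∀ X Y : ℝ → ℝ, P.IsEquilibriumCurve X → P.IsEquilibriumCurve Y →
    ¬ EqOn X Y (Icc P.lm P.lp) → ∀ l ∈ Icc P.lm P.lp, d0 < |X l - Y l|

/-- Solutions of `x' = f (x, Λ (r t))`. Since `f` is bounded, all maximal solutions are global. -/
def IsSolution (P : RateProblem) (r : ℝ) (x : ℝ → ℝ) : Prop :=
  ∀ t : ℝ, HasDerivAt x (P.f (x t) (P.Lam (r * t))) t

/-- `P.sol r s x0 t` is the value at time `t` of the solution that takes the value `x0` at
time `s`. -/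
def sol (P : RateProblem) (r s x0 : ℝ) : ℝ → ℝ :=
  Classical.epsilon fun x : ℝ → ℝ => P.IsSolution r x ∧ x s = x0

/-- The solution that converges to the past stable equilibrium as `t → -∞`. -/
def xMinus (P : RateProblem) (r : ℝ) : ℝ → ℝ :=
  Classical.epsilon fun x : ℝ → ℝ =>
    P.IsSolution r x ∧ Tendsto x atBot (𝓝 (P.Xs P.lm))

/-- The solution that converges to the future unstable equilibrium as `t → ∞`. -/
def xPlus (P : RateProblem) (r : ℝ) : ℝ → ℝ :=
  Classical.epsilon fun x : ℝ → ℝ =>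
    P.IsSolution r x ∧ Tendsto x atTop (𝓝 (P.Xu P.lp))

/-- `x` is locally pullback attracting on `(-∞, s0]`, with radius of attraction `δ`. The initial
value `ξ s` is any value in the `δ`-ball around `x s`. -/
def IsPullbackAttractingOn (P : RateProblem) (r : ℝ) (x : ℝ → ℝ) (s0 δ : ℝ) : Prop :=
  ∀ ξ : ℝ → ℝ, (∀ s ≤ s0, |ξ s - x s| < δ) →
    ∀ t ≤ s0, Tendsto (fun s => |x t - P.sol r s (ξ s) t|) atBot (𝓝 0)

/-- `x` is locally pullback repelling on `[s0, ∞)`, with radius of repulsion `δ`. -/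
def IsPullbackRepellingOn (P : RateProblem) (r : ℝ) (x : ℝ → ℝ) (s0 δ : ℝ) : Prop :=
  ∀ ξ : ℝ → ℝ, (∀ s ≥ s0, |ξ s - x s| < δ) →
    ∀ t ≥ s0, Tendsto (fun s => |x t - P.sol r s (ξ s) t|) atTop (𝓝 0)

theorem blocksFun_lt_of_two_le_length {n : ℕ} (c : Composition n) (hc : 2 ≤ c.length)
    (l : Fin c.length) : c.blocksFun l < n := by
  have hne : c ≠ Composition.single n (lt_of_lt_of_le (by omega) c.length_le) := by
    intro h
    rw [h, Composition.single_length] at hc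
    omega
  exact (Composition.ne_single_iff _).1 hne l

/-- The coefficients of the formal solution `∑ aᵢ(τ) rⁱ` of `r dx/dτ = f (x, Λ(τ))` with
`a₀(τ) = X(Λ(τ))`. The sum is over all `(k₁, …, kⱼ)` with `j ≥ 2`, `kₗ ≥ 1` and
`k₁ + ⋯ + kⱼ = i`. -/
def seriesCoeff (P : RateProblem) (X : ℝ → ℝ) : ℕ → ℝ → ℝ
  | 0 => fun τ => X (P.Lam τ)
  | i + 1 => fun τ =>
      (deriv (seriesCoeff P X i) τ -
        ∑ c : {c : Composition (i + 1) // 2 ≤ c.length},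
          iteratedDeriv c.1.length (fun y => P.f y (P.Lam τ)) (X (P.Lam τ)) / (c.1.length ! : ℝ) *
            ∏ l : Fin c.1.length, seriesCoeff P X (c.1.blocksFun l) τ) /
        P.dfx (X (P.Lam τ)) (P.Lam τ)
  termination_by i => i
  decreasing_by
    · exact Nat.lt_succ_self i
    · exact blocksFun_lt_of_two_le_length c.1 c.2 l

/-- The truncated asymptotic series `Sₙ(r, t) = ∑_{i ≤ n} aᵢ(r t) rⁱ`. -/
def S (P : RateProblem) (X : ℝ → ℝ) (n : ℕ) (r t : ℝ) : ℝ :=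
  ∑ i ∈ Finset.range (n + 1), P.seriesCoeff X i (r * t) * r ^ i

def yMinus (P : RateProblem) (n : ℕ) (ε r t t0 : ℝ) : ℝ := P.sol r t0 (P.S P.Xs n r t0 + ε) t

def yPlus (P : RateProblem) (n : ℕ) (ε r t t0 : ℝ) : ℝ := P.sol r t0 (P.S P.Xu n r t0 - ε) t

def zMinus (P : RateProblem) (n : ℕ) (ε r t t0 : ℝ) : ℝ := P.sol r t0 (P.S P.Xs n r t0 - ε) t

def zPlus (P : RateProblem) (n : ℕ) (ε r t t0 : ℝ) : ℝ := P.sol r t0 (P.S P.Xu n r t0 + ε) t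

def Dout (P : RateProblem) (n : ℕ) (ε τ r : ℝ) : ℝ :=
  P.yMinus n ε r 0 (-τ) - P.yPlus n ε r 0 τ

def Din (P : RateProblem) (n : ℕ) (ε τ r : ℝ) : ℝ :=
  P.zMinus n ε r 0 (-τ) - P.zPlus n ε r 0 τ

/-- `xMinus r` end-point tracks the curve of stable equilibria. -/
def EndPointTracks (P : RateProblem) (r : ℝ) : Prop :=
  Tendsto (P.xMinus r) atTop (𝓝 (P.Xs P.lp))

/-- `xMinus` and `xPlus` collide in a rate-induced tipping at `rs`. -/
def CollideInTipping (P : RateProblem) (rs : ℝ) : Prop :=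
  P.xMinus rs = P.xPlus rs ∧ ∃ η > 0, ∀ r ∈ Ioo (rs - η) rs, P.EndPointTracks r

/-- `xMinus` and `xPlus` collide in a visible rate-induced tipping at `rs`. -/
def CollideInVisibleTipping (P : RateProblem) (rs : ℝ) : Prop :=
  ∃ δ > 0,
    (∀ r ∈ Ioo (rs - δ) rs, P.EndPointTracks r ∧ ∀ t : ℝ, P.xPlus r t < P.xMinus r t) ∧
    P.xMinus rs = P.xPlus rs ∧
    ∀ r ∈ Ioo rs (rs + δ), ∀ t : ℝ, P.xMinus r t < P.xPlus r t

end RateProblem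

end

/-! Everything is decided by the gap g(r) = `xMinus r 0` - `xPlus r 0`. Scalar trajectories do not
cross, so the sign of g orders the two solutions for all time and a zero of g is a collision. Both
solutions depend continuously on r > 0 (`continuousAt_xMinus`, `continuousAt_xPlus`), hence so does
g.

`Din` and `Dout` approximate g. As τ → ∞ both tend to g(r), by pullback attraction and repulsion
(`tendsto_D`). At early and late times S_n is close to the limiting equilibrium, so the shifts by ±ε
bracket the two special solutions and `Din` < g < `Dout` for large τ, uniformly for r in a compact
interval of positive rates (`Din_lt_sub_lt_Dout`). There S_n^s - ε is also a strict subsolution,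
which makes `Din` nondecreasing in τ (`Din_mono`). For slow drift, X^s(Λ(rt)) - ρ is a subsolution
for all time, and 2ε < d0 keeps `Din` above a positive constant (`exists_le_Din`). The equivalences
are then sign arguments combining the strict bracket, the limit in τ and continuity in r.

Near a collision rate r*, end-point tracking follows from g(r) > 0 (`exists_endPointTracks`). At r*
the solution `xMinus` ends at X^u, so at some late time it is below a barrier just above X^s. This
persists for nearby r, and a solution below the barrier and above `xPlus` converges to X^s
(`tendsto_of_gt_xPlus`).

The substitution x(t) ↦ -x(-t) exchanges X^s in the past with X^u in the future. Thus most estimates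
are proved on the stable side only, and `rev` supplies the others. -/

namespace RateProblem

/-! ### Standing assumptions and the reversal symmetry -/

/-- The part of the assumptions that is preserved by the reversal of time and space `rev`. -/
structure Admissible (P : RateProblem) : Prop where
  contDiff_f : ContDiff ℝ ∞ (Function.uncurry P.f)
  bounded_f : ∃ M : ℝ, ∀ x : ℝ, ∀ l ∈ Icc P.lm P.lp, |P.f x l| ≤ M
  continuous_Lam : Continuous P.Lam
  Lam_mem : ∀ τ, P.Lam τ ∈ Icc P.lm P.lp
  tendsto_Lam_atBot : Tendsto P.Lam atBot (𝓝 P.lm)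
  tendsto_Lam_atTop : Tendsto P.Lam atTop (𝓝 P.lp)
  lm_le_lp : P.lm ≤ P.lp
  curve_Xs : P.IsEquilibriumCurve P.Xs
  curve_Xu : P.IsEquilibriumCurve P.Xu
  stable_Xs : ∀ l ∈ Icc P.lm P.lp, P.dfx (P.Xs l) l < 0
  unstable_Xu : ∀ l ∈ Icc P.lm P.lp, 0 < P.dfx (P.Xu l) l
  Xu_lt_Xs : ∀ l ∈ Icc P.lm P.lp, P.Xu l < P.Xs l
  pos_between : ∀ l ∈ Icc P.lm P.lp, ∀ x ∈ Ioo (P.Xu l) (P.Xs l), 0 < P.f x l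

/-- The problem solved by `t ↦ -x (-t)` when `x` solves the problem `P`. -/
def rev (P : RateProblem) : RateProblem where
  f := fun x l => P.f (-x) (-l)
  Lam := fun τ => -P.Lam (-τ)
  lm := -P.lp
  lp := -P.lm
  Xs := fun l => -P.Xu (-l)
  Xu := fun l => -P.Xs (-l)

variable {P : RateProblem}

theorem rev_rev (P : RateProblem) : P.rev.rev = P := by
  cases P; simp [rev]

theorem dfx_rev (P : RateProblem) (x l : ℝ) : P.rev.dfx x l = -P.dfx (-x) (-l) := by
  simp only [dfx, rev]
  exact deriv_comp_neg (fun y => P.f y (-l)) x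

theorem mem_Icc_rev {l : ℝ} (hl : l ∈ Icc P.rev.lm P.rev.lp) : -l ∈ Icc P.lm P.lp := by
  simp only [rev, mem_Icc] at hl ⊢
  constructor <;> linarith [hl.1, hl.2]

theorem IsEquilibriumCurve.rev {X : ℝ → ℝ} (h : P.IsEquilibriumCurve X) :
    P.rev.IsEquilibriumCurve fun l => -X (-l) := by
  refine ⟨(h.1.comp continuousOn_neg fun l hl => mem_Icc_rev hl).neg, fun l hl => ?_⟩
  have := h.2 (-l) (mem_Icc_rev hl)
  refine ⟨by simpa [RateProblem.rev] using this.1, ?_⟩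
  rw [dfx_rev]
  simpa using this.2

/-- Reversal keeps the sign of f, flips the sign of its x-derivative and reverses the order in x.
The two curves exchange stability, and the stable one is again the upper one. Negating the parameter
keeps `lm` ≤ `lp`. -/
theorem Admissible.rev (h : P.Admissible) : P.rev.Admissible where
  contDiff_f := by
    have : Function.uncurry P.rev.f = Function.uncurry P.f ∘ fun p : ℝ × ℝ => (-p.1, -p.2) := by
      ext p; rfl
    rw [this]
    exact h.contDiff_f.comp (by fun_prop)
  bounded_f := by
    obtain ⟨M, hM⟩ := h.bounded_f
    exact ⟨M, fun x l hl => hM _ _ (mem_Icc_rev hl)⟩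
  continuous_Lam := (h.continuous_Lam.comp continuous_neg).neg
  Lam_mem := fun τ => by
    have := h.Lam_mem (-τ)
    simp only [RateProblem.rev, mem_Icc] at this ⊢
    constructor <;> linarith [this.1, this.2]
  tendsto_Lam_atBot := (h.tendsto_Lam_atTop.comp tendsto_neg_atBot_atTop).neg
  tendsto_Lam_atTop := (h.tendsto_Lam_atBot.comp tendsto_neg_atTop_atBot).neg
  lm_le_lp := neg_le_neg h.lm_le_lp
  curve_Xs := h.curve_Xu.rev
  curve_Xu := h.curve_Xs.rev
  stable_Xs := fun l hl => by
    rw [dfx_rev]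
    simpa [RateProblem.rev] using h.unstable_Xu (-l) (mem_Icc_rev hl)
  unstable_Xu := fun l hl => by
    rw [dfx_rev]
    simpa [RateProblem.rev] using h.stable_Xs (-l) (mem_Icc_rev hl)
  Xu_lt_Xs := fun l hl => neg_lt_neg (h.Xu_lt_Xs _ (mem_Icc_rev hl))
  pos_between := fun l hl x hx => h.pos_between (-l) (mem_Icc_rev hl) (-x)
    ⟨by simp only [RateProblem.rev, mem_Ioo] at hx; linarith [hx.2],
     by simp only [RateProblem.rev, mem_Ioo] at hx; linarith [hx.1]⟩

theorem Admissible.lm_mem (h : P.Admissible) : P.lm ∈ Icc P.lm P.lp := ⟨le_rfl, h.lm_le_lp⟩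

theorem Admissible.lp_mem (h : P.Admissible) : P.lp ∈ Icc P.lm P.lp := ⟨h.lm_le_lp, le_rfl⟩

theorem Admissible.continuous_f (h : P.Admissible) : Continuous (Function.uncurry P.f) :=
  h.contDiff_f.continuous

theorem hasDerivAt_f_left (hf : ContDiff ℝ ∞ (Function.uncurry P.f)) (x l : ℝ) :
    HasDerivAt (fun y => P.f y l) (P.dfx x l) x := by
  have : Differentiable ℝ (Function.uncurry P.f) := hf.differentiable (by simp)
  exact (this.comp (g := Function.uncurry P.f) (f := fun y => (y, l))
    (by fun_prop) x).hasDerivAt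

theorem Admissible.hasDerivAt_f (h : P.Admissible) (x l : ℝ) :
    HasDerivAt (fun y => P.f y l) (P.dfx x l) x :=
  hasDerivAt_f_left h.contDiff_f x l

theorem Admissible.exists_lipschitzOnWith (h : P.Admissible) (R : ℝ) :
    ∃ K, LipschitzOnWith K (Function.uncurry P.f) (Icc (-R) R ×ˢ Icc P.lm P.lp) :=
  (h.contDiff_f.of_le (by simp)).locallyLipschitz.locallyLipschitzOn
    |>.exists_lipschitzOnWith_of_compact (isCompact_Icc.prod isCompact_Icc)

theorem Admissible.exists_lipschitzOnWith_right (h : P.Admissible) (R : ℝ) :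
    ∃ K, ∀ τ, LipschitzOnWith K (fun x => P.f x (P.Lam τ)) (Icc (-R) R) := by
  obtain ⟨K, hK⟩ := h.exists_lipschitzOnWith R
  refine ⟨K, fun τ => LipschitzOnWith.of_dist_le_mul fun x hx y hy => ?_⟩
  have := hK.dist_le_mul (x, P.Lam τ) ⟨hx, h.Lam_mem τ⟩ (y, P.Lam τ) ⟨hy, h.Lam_mem τ⟩
  simpa [Prod.dist_eq] using this

/-! ### Global existence, uniqueness, comparison and continuous dependence -/

theorem IsSolution.continuous {r : ℝ} {x : ℝ → ℝ} (hx : P.IsSolution r x) : Continuous x :=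
  continuous_iff_continuousAt.2 fun t => (hx t).continuousAt

theorem IsSolution.rev {r : ℝ} {x : ℝ → ℝ} (hx : P.IsSolution r x) :
    P.rev.IsSolution r fun t => -x (-t) := by
  intro t
  refine (((hx (-t)).comp t (hasDerivAt_neg t)).neg).congr_deriv ?_
  simp [RateProblem.rev]

theorem isSolution_of_rev {r : ℝ} {x : ℝ → ℝ} (hx : P.rev.IsSolution r x) :
    P.IsSolution r fun t => -x (-t) := by
  have := hx.rev
  rwa [rev_rev] at this

theorem eqOn_Icc_of_deriv (h : P.Admissible) {r : ℝ} {x y : ℝ → ℝ} {a b s : ℝ} (hs : s ∈ Ioo a b)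
    (hx : ∀ t ∈ Icc a b, HasDerivWithinAt x (P.f (x t) (P.Lam (r * t))) (Icc a b) t)
    (hy : ∀ t ∈ Icc a b, HasDerivWithinAt y (P.f (y t) (P.Lam (r * t))) (Icc a b) t)
    (hxy : x s = y s) : EqOn x y (Icc a b) := by
  have cx : ContinuousOn x (Icc a b) := fun t ht => (hx t ht).continuousWithinAt
  have cy : ContinuousOn y (Icc a b) := fun t ht => (hy t ht).continuousWithinAt
  obtain ⟨A, hA⟩ := isCompact_Icc.exists_bound_of_continuousOn cx
  obtain ⟨B, hB⟩ := isCompact_Icc.exists_bound_of_continuousOn cy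
  obtain ⟨K, hK⟩ := h.exists_lipschitzOnWith_right (max A B)
  have hI : ∀ t ∈ Ioo a b, Icc a b ∈ 𝓝 t := fun t ht => Icc_mem_nhds ht.1 ht.2
  have mem : ∀ z C, |z| ≤ C → C ≤ max A B → z ∈ Icc (-(max A B)) (max A B) := fun z C h1 h2 =>
    abs_le.1 (h1.trans h2)
  exact ODE_solution_unique_of_mem_Icc (v := fun t x => P.f x (P.Lam (r * t)))
    (s := fun _ => Icc (-(max A B)) (max A B)) (fun t _ => hK (r * t)) hs cx
    (fun t ht => (hx t (Ioo_subset_Icc_self ht)).hasDerivAt (hI t ht))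
    (fun t ht => mem _ _ (hA t (Ioo_subset_Icc_self ht)) (le_max_left _ _)) cy
    (fun t ht => (hy t (Ioo_subset_Icc_self ht)).hasDerivAt (hI t ht))
    (fun t ht => mem _ _ (hB t (Ioo_subset_Icc_self ht)) (le_max_right _ _)) hxy

theorem IsSolution.eq (h : P.Admissible) {r : ℝ} {x y : ℝ → ℝ} (hx : P.IsSolution r x)
    (hy : P.IsSolution r y) {s : ℝ} (hxy : x s = y s) : x = y := by
  ext t
  have hs : s ∈ Ioo (min s t - 1) (max s t + 1) :=
    ⟨by linarith [min_le_left s t], by linarith [le_max_left s t]⟩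
  have ht : t ∈ Icc (min s t - 1) (max s t + 1) :=
    ⟨by linarith [min_le_right s t], by linarith [le_max_right s t]⟩
  exact eqOn_Icc_of_deriv h hs (fun t _ => (hx t).hasDerivWithinAt)
    (fun t _ => (hy t).hasDerivWithinAt) hxy ht

/-- Since |f| ≤ M everywhere, a solution moves at most M * T in time T, so Picard–Lindelöf on the
ball of radius M * T works for arbitrarily large T. -/
theorem exists_solution_Icc (h : P.Admissible) (r s x0 : ℝ) (T : ℝ) (hT : 0 ≤ T) :
    ∃ x : ℝ → ℝ, x s = x0 ∧ ∀ t ∈ Icc (s - T) (s + T),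
      HasDerivWithinAt x (P.f (x t) (P.Lam (r * t))) (Icc (s - T) (s + T)) t := by
  obtain ⟨M, hM⟩ := h.bounded_f
  have hM0 : 0 ≤ M := (abs_nonneg _).trans (hM 0 _ h.lm_mem)
  obtain ⟨K, hK⟩ := h.exists_lipschitzOnWith_right (|x0| + M * T)
  have hs : s ∈ Icc (s - T) (s + T) := ⟨by linarith, by linarith⟩
  have hpl : IsPicardLindelof (fun t x => P.f x (P.Lam (r * t))) ⟨s, hs⟩ x0
      (⟨M * T, by positivity⟩ : NNReal) 0 ⟨M, hM0⟩ K := by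
    refine ⟨fun t _ => (hK (r * t)).mono ?_, fun x _ => ?_, fun t _ x _ => hM _ _ (h.Lam_mem _), ?_⟩
    · intro x hx
      rw [Metric.mem_closedBall, Real.dist_eq] at hx
      change |x - x0| ≤ M * T at hx
      apply abs_le.1
      have := abs_add_le (x - x0) x0
      rw [sub_add_cancel] at this
      linarith
    · have : Continuous fun t => Function.uncurry P.f (x, P.Lam (r * t)) :=
        h.continuous_f.comp (continuous_const.prodMk
          (h.continuous_Lam.comp (continuous_const.mul continuous_id)))
      exact this.continuousOn
    · change M * max (s + T - s) (s - (s - T)) ≤ M * T - 0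
      simp
  exact hpl.exists_eq_forall_mem_Icc_hasDerivWithinAt₀

theorem exists_isSolution (h : P.Admissible) (r s x0 : ℝ) :
    ∃ x : ℝ → ℝ, P.IsSolution r x ∧ x s = x0 := by
  have key := fun N : ℕ => exists_solution_Icc h r s x0 (N + 1) (by positivity)
  choose α hα0 hα using key
  have agree : ∀ N M : ℕ, N ≤ M → EqOn (α N) (α M) (Icc (s - (N + 1)) (s + (N + 1))) := by
    intro N M hNM
    have hNM' : (N : ℝ) ≤ M := by exact_mod_cast hNM
    have hN0 : (0 : ℝ) ≤ N := by positivity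
    have hsub : Icc (s - (N + 1 : ℝ)) (s + (N + 1)) ⊆ Icc (s - (M + 1)) (s + (M + 1)) :=
      Icc_subset_Icc (by linarith) (by linarith)
    exact eqOn_Icc_of_deriv h (s := s) ⟨by linarith, by linarith⟩ (hα N)
      (fun t ht => (hα M t (hsub ht)).mono hsub) (by rw [hα0, hα0])
  have hN : ∀ t : ℝ, |t - s| ≤ (⌈|t - s|⌉₊ : ℝ) := fun t => Nat.le_ceil _
  have val : ∀ N : ℕ, ∀ t ∈ Icc (s - (N + 1)) (s + (N + 1)), α ⌈|t - s|⌉₊ t = α N t := by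
    intro N t ht
    have h1 : t ∈ Icc (s - (⌈|t - s|⌉₊ + 1 : ℝ)) (s + (⌈|t - s|⌉₊ + 1)) := by
      have := abs_le.1 (hN t)
      exact ⟨by linarith [this.1], by linarith [this.2]⟩
    rcases le_total ⌈|t - s|⌉₊ N with hle | hle
    · exact agree _ _ hle h1
    · exact (agree _ _ hle ht).symm
  -- The local solutions are glued. The interval used at t has half-length ⌈|t - s|⌉ + 1, so t is
  -- interior and the derivative is two-sided.
  refine ⟨fun t => α ⌈|t - s|⌉₊ t, fun t => ?_, ?_⟩
  · set N := ⌈|t - s|⌉₊ with hNdef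
    have hlt := abs_le.1 (hN t)
    have hmem : Icc (s - (N + 1 : ℝ)) (s + (N + 1)) ∈ 𝓝 t :=
      Icc_mem_nhds (by linarith [hlt.1]) (by linarith [hlt.2])
    have h1 := (hα N t (mem_of_mem_nhds hmem)).hasDerivAt hmem
    exact h1.congr_of_eventuallyEq (by filter_upwards [hmem] with u hu using val N u hu)
  · simpa using hα0 0

theorem sol_spec (h : P.Admissible) (r s x0 : ℝ) :
    P.IsSolution r (P.sol r s x0) ∧ P.sol r s x0 s = x0 :=
  Classical.epsilon_spec (exists_isSolution h r s x0)

theorem isSolution_sol (h : P.Admissible) (r s x0 : ℝ) : P.IsSolution r (P.sol r s x0) :=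
  (sol_spec h r s x0).1

theorem sol_self (h : P.Admissible) (r s x0 : ℝ) : P.sol r s x0 s = x0 := (sol_spec h r s x0).2

theorem rev_sol (h : P.Admissible) (r s x0 t : ℝ) :
    P.rev.sol r s x0 t = -P.sol r (-s) (-x0) (-t) := by
  have h1 := (isSolution_sol h r (-s) (-x0)).rev
  have := h1.eq h.rev (isSolution_sol h.rev r s x0) (s := s)
    (by rw [sol_self h.rev]; simp [sol_self h])
  exact (congrFun this t).symm

/-- If the order changed, the graphs would meet and the solutions would coincide. No order between s
and t is needed, so comparison also runs backward in time. -/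
theorem IsSolution.lt (h : P.Admissible) {r : ℝ} {x y : ℝ → ℝ} (hx : P.IsSolution r x)
    (hy : P.IsSolution r y) {s : ℝ} (hxy : x s < y s) (t : ℝ) : x t < y t := by
  by_contra! hcon
  have hc : Continuous fun t => y t - x t := hy.continuous.sub hx.continuous
  obtain ⟨u, -, hu⟩ : (0 : ℝ) ∈ (fun t => y t - x t) '' univ := by
    refine isPreconnected_univ.image _ hc.continuousOn |>.ordConnected.out
      (mem_image_of_mem _ (mem_univ t)) (mem_image_of_mem _ (mem_univ s)) ⟨?_, ?_⟩
    · linarith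
    · linarith
  have := hx.eq h hy (s := u) (by simp only at hu; linarith)
  rw [this] at hxy
  exact lt_irrefl _ hxy

theorem IsSolution.le (h : P.Admissible) {r : ℝ} {x y : ℝ → ℝ} (hx : P.IsSolution r x)
    (hy : P.IsSolution r y) {s : ℝ} (hxy : x s ≤ y s) (t : ℝ) : x t ≤ y t := by
  rcases hxy.lt_or_eq with h1 | h1
  · exact (hx.lt h hy h1 t).le
  · rw [hx.eq h hy h1]

theorem IsSolution.le_add (h : P.Admissible) {M : ℝ}
    (hM : ∀ x : ℝ, ∀ l ∈ Icc P.lm P.lp, |P.f x l| ≤ M)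
    {r : ℝ} {x : ℝ → ℝ} (hx : P.IsSolution r x) (s t : ℝ) : |x t - x s| ≤ M * |t - s| := by
  have := convex_univ.norm_image_sub_le_of_norm_hasDerivWithin_le (f := x) (C := M)
    (fun t _ => (hx t).hasDerivWithinAt) (fun t _ => hM _ _ (h.Lam_mem _)) (mem_univ s) (mem_univ t)
  simpa using this

/-- Grönwall: the solution at rate r is an approximate trajectory of the equation at rate r0, the
error coming from the change of Λ(ru) on a compact time interval. -/
theorem continuousAt_solution_of_le (h : P.Admissible) {x : ℝ → ℝ → ℝ} {r0 s t : ℝ} (hst : s ≤ t)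
    (hx : ∀ᶠ r in 𝓝 r0, P.IsSolution r (x r)) (hs : ContinuousAt (fun r => x r s) r0) :
    ContinuousAt (fun r => x r t) r0 := by
  obtain ⟨M, hM⟩ := h.bounded_f
  have hM0 : 0 ≤ M := (abs_nonneg _).trans (hM 0 _ h.lm_mem)
  set y := x r0 with hy
  have hysol : P.IsSolution r0 y := hx.self_of_nhds
  -- A solution starting within 1 of `y s` with speed at most M stays in [-R, R] up to time t.
  set R := |y s| + 1 + M * (t - s) with hR
  obtain ⟨K, hK⟩ := h.exists_lipschitzOnWith R
  rw [Metric.continuousAt_iff'] at hs ⊢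
  intro e he
  have hlim : Tendsto (fun d : ℝ => gronwallBound d K (K * d + 0) (t - s)) (𝓝 0) (𝓝 0) := by
    have : Continuous fun d : ℝ => gronwallBound d K (K * d + 0) (t - s) := by
      by_cases hK0 : (K : ℝ) = 0
      · simp only [hK0, gronwallBound_K0]; fun_prop
      · simp only [gronwallBound_of_K_ne_0 hK0]; fun_prop
    have h2 := this.tendsto 0
    simpa [gronwallBound_ε0_δ0] using h2
  -- A single d bounds both the initial discrepancy and the change in Λ; the latter perturbs the
  -- vector field by at most K * d.
  obtain ⟨d, hd, hd0, hd1⟩ : ∃ d : ℝ, gronwallBound d K (K * d + 0) (t - s) < e ∧ 0 < d ∧ d < 1 := by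
    have h1 : ∀ᶠ d in 𝓝[>] (0 : ℝ), gronwallBound d K (K * d + 0) (t - s) < e :=
      (hlim.eventually (gt_mem_nhds he)).filter_mono nhdsWithin_le_nhds
    have h2 : ∀ᶠ d in 𝓝[>] (0 : ℝ), d ∈ Ioo (0 : ℝ) 1 := Ioo_mem_nhdsGT one_pos
    obtain ⟨d, h3, h4⟩ := (h1.and h2).exists
    exact ⟨d, h3, h4.1, h4.2⟩
  have hLam : ∀ᶠ r in 𝓝 r0, ∀ u ∈ Icc s t, dist (P.Lam (r * u)) (P.Lam (r0 * u)) < d := by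
    refine isCompact_Icc.eventually_forall_of_forall_eventually fun u _ => ?_
    have hc : Continuous fun p : ℝ × ℝ => dist (P.Lam (p.1 * p.2)) (P.Lam (r0 * p.2)) :=
      (h.continuous_Lam.comp (continuous_fst.mul continuous_snd)).dist
        (h.continuous_Lam.comp (continuous_const.mul continuous_snd))
    exact hc.tendsto (r0, u) |>.eventually (gt_mem_nhds (by simpa using hd0))
  filter_upwards [hx, hs d hd0, hLam] with r hr hrs hrL
  have bd : ∀ z : ℝ → ℝ, ∀ ρ, P.IsSolution ρ z → |z s - y s| ≤ 1 → ∀ u ∈ Icc s t,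
      z u ∈ Icc (-R) R := by
    intro z ρ hz hzs u hu
    apply abs_le.1
    have h1 := hz.le_add h hM s u
    have h2 : M * |u - s| ≤ M * (t - s) := by
      rw [abs_of_nonneg (by linarith [hu.1])]
      exact mul_le_mul_of_nonneg_left (by linarith [hu.2]) hM0
    have h3 : |z u| ≤ |z u - z s| + |z s - y s| + |y s| := by
      have := abs_add_three (z u - z s) (z s - y s) (y s)
      simpa using this
    linarith
  have hxR := bd _ r hr (by rw [← Real.dist_eq]; linarith)
  have hyR := bd _ r0 hysol (by simp)
  have := dist_le_of_approx_trajectories_ODE_of_mem (v := fun u x => P.f x (P.Lam (r0 * u)))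
    (s := fun _ => Icc (-R) R) (K := K) (f := x r) (g := y) (a := s) (b := t) (δ := d)
    (f' := fun u => P.f (x r u) (P.Lam (r * u))) (g' := fun u => P.f (y u) (P.Lam (r0 * u)))
    (εf := K * d) (εg := 0)
    (fun u _ => LipschitzOnWith.of_dist_le_mul fun a ha b hb => by
      have := hK.dist_le_mul (a, P.Lam (r0 * u)) ⟨ha, h.Lam_mem _⟩
        (b, P.Lam (r0 * u)) ⟨hb, h.Lam_mem _⟩
      simpa [Prod.dist_eq] using this)
    hr.continuous.continuousOn (fun u _ => (hr u).hasDerivWithinAt)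
    (fun u hu => by
      have h1 := hK.dist_le_mul (x r u, P.Lam (r * u))
        ⟨hxR u (Ico_subset_Icc_self hu), h.Lam_mem _⟩ (x r u, P.Lam (r0 * u))
        ⟨hxR u (Ico_subset_Icc_self hu), h.Lam_mem _⟩
      refine h1.trans (mul_le_mul_of_nonneg_left ?_ K.2)
      simpa [Prod.dist_eq] using (hrL u (Ico_subset_Icc_self hu)).le)
    (fun u hu => hxR u (Ico_subset_Icc_self hu))
    hysol.continuous.continuousOn (fun u _ => (hysol u).hasDerivWithinAt)
    (fun u _ => by simp) (fun u hu => hyR u (Ico_subset_Icc_self hu)) hrs.le t ⟨hst, le_rfl⟩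
  exact this.trans_lt hd

theorem continuousAt_solution (h : P.Admissible) {x : ℝ → ℝ → ℝ} {r0 s : ℝ} (t : ℝ)
    (hx : ∀ᶠ r in 𝓝 r0, P.IsSolution r (x r)) (hs : ContinuousAt (fun r => x r s) r0) :
    ContinuousAt (fun r => x r t) r0 := by
  rcases le_total s t with hst | hst
  · exact continuousAt_solution_of_le h hst hx hs
  · have := continuousAt_solution_of_le h.rev (x := fun r t => -x r (-t)) (s := -s) (t := -t)
      (neg_le_neg hst) (hx.mono fun r hr => hr.rev) (by simp only [neg_neg]; exact hs.neg)
    have h2 := this.neg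
    simp only [neg_neg] at h2
    exact h2.congr (by filter_upwards with r; simp)

/-! ### Barriers and contraction near a hyperbolic stable equilibrium -/

theorem Admissible.dfx_eq (h : P.Admissible) (x l : ℝ) :
    P.dfx x l = fderiv ℝ (Function.uncurry P.f) (x, l) (1, 0) := by
  have hd : Differentiable ℝ (Function.uncurry P.f) := h.contDiff_f.differentiable (by simp)
  have h1 : HasDerivAt (fun y : ℝ => (y, l)) ((1 : ℝ), (0 : ℝ)) x :=
    (hasDerivAt_id x).prodMk (hasDerivAt_const x l)
  exact ((hd (x, l)).hasFDerivAt.comp_hasDerivAt x h1).deriv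

theorem Admissible.continuous_dfx (h : P.Admissible) :
    Continuous fun p : ℝ × ℝ => P.dfx p.1 p.2 := by
  simp only [h.dfx_eq]
  exact (h.contDiff_f.continuous_fderiv (by simp)).clm_apply continuous_const

theorem Admissible.continuous_f_right (h : P.Admissible) (x : ℝ) : Continuous fun l => P.f x l :=
  h.continuous_f.comp (f := fun l => (x, l)) (by fun_prop)

theorem Admissible.exists_dfx_le (h : P.Admissible) {l0 : ℝ} (hl0 : l0 ∈ Icc P.lm P.lp) :
    ∃ α > 0, ∃ η > 0, ∀ᶠ l in 𝓝 l0, ∀ x ∈ Icc (P.Xs l0 - η) (P.Xs l0 + η), P.dfx x l ≤ -α := by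
  have h1 := h.stable_Xs l0 hl0
  have h2 : ∀ᶠ p in 𝓝 (P.Xs l0, l0), P.dfx p.1 p.2 < P.dfx (P.Xs l0) l0 / 2 :=
    h.continuous_dfx.tendsto (P.Xs l0, l0) |>.eventually (gt_mem_nhds (by simp only; linarith))
  rw [nhds_prod_eq] at h2
  obtain ⟨p1, hp1, p2, hp2, h3⟩ := eventually_prod_iff.1 h2
  obtain ⟨η, hη, h4⟩ := Metric.nhds_basis_closedBall.eventually_iff.1 hp1
  refine ⟨-(P.dfx (P.Xs l0) l0 / 2), by linarith, η, hη, hp2.mono fun l hl x hx => ?_⟩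
  rw [neg_neg]
  rw [← Real.closedBall_eq_Icc] at hx
  exact (h3 (h4 hx) hl).le

theorem Admissible.f_sub_le (h : P.Admissible) {a b l α : ℝ}
    (hd : ∀ x ∈ Icc a b, P.dfx x l ≤ -α) {x y : ℝ} (hx : x ∈ Icc a b) (hy : y ∈ Icc a b)
    (hxy : x ≤ y) : P.f y l - P.f x l ≤ -α * (y - x) := by
  refine (convex_Icc a b).image_sub_le_mul_sub_of_deriv_le (f := fun x => P.f x l)
    (fun x _ => (h.hasDerivAt_f x l).continuousAt.continuousWithinAt)
    (fun x _ => (h.hasDerivAt_f x l).differentiableAt.differentiableWithinAt)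
    (fun x hx => ?_) x hx y hy hxy
  rw [(h.hasDerivAt_f x l).deriv]
  exact hd x (interior_subset hx)

/-- Near a hyperbolic stable equilibrium, the vector field points inwards. -/
theorem Admissible.exists_inward (h : P.Admissible) {l0 : ℝ} (hl0 : l0 ∈ Icc P.lm P.lp) :
    ∃ α > 0, ∃ η0 > 0,
      (∀ᶠ l in 𝓝 l0, ∀ x ∈ Icc (P.Xs l0 - η0) (P.Xs l0 + η0), P.dfx x l ≤ -α) ∧
      (∀ x ∈ Ioc (P.Xs l0) (P.Xs l0 + η0), P.f x l0 < 0) ∧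
      (∀ x ∈ Ico (P.Xs l0 - η0) (P.Xs l0), 0 < P.f x l0) ∧
      ∀ η ∈ Ioc 0 η0, ∀ᶠ l in 𝓝 l0, P.f (P.Xs l0 + η) l < 0 ∧ 0 < P.f (P.Xs l0 - η) l := by
  obtain ⟨α, hα, η0, hη0, h1⟩ := h.exists_dfx_le hl0
  have h0 := (h.curve_Xs.2 l0 hl0).1
  have hc : P.Xs l0 ∈ Icc (P.Xs l0 - η0) (P.Xs l0 + η0) := ⟨by linarith, by linarith⟩
  have hup : ∀ x ∈ Ioc (P.Xs l0) (P.Xs l0 + η0), P.f x l0 < 0 := fun x hx => by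
    have := h.f_sub_le h1.self_of_nhds hc ⟨by linarith [hx.1], hx.2⟩ hx.1.le
    nlinarith [hx.1]
  have hdn : ∀ x ∈ Ico (P.Xs l0 - η0) (P.Xs l0), 0 < P.f x l0 := fun x hx => by
    have := h.f_sub_le h1.self_of_nhds ⟨hx.1, by linarith [hx.2]⟩ hc hx.2.le
    nlinarith [hx.2]
  refine ⟨α, hα, η0, hη0, h1, hup, hdn, fun η hη => ?_⟩
  have e1 := (h.continuous_f_right (P.Xs l0 + η)).tendsto l0 |>.eventually
    (gt_mem_nhds (hup _ ⟨by linarith [hη.1], by linarith [hη.2]⟩))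
  have e2 := (h.continuous_f_right (P.Xs l0 - η)).tendsto l0 |>.eventually
    (lt_mem_nhds (hdn _ ⟨by linarith [hη.2], by linarith [hη.1]⟩))
  exact e1.and e2

/-- A strict subsolution: wherever the barrier touches the solution, it rises more slowly and cannot
cross. -/
theorem IsSolution.ge_of_lower {r : ℝ} {x : ℝ → ℝ} (hx : P.IsSolution r x) {b b' : ℝ → ℝ}
    {s t : ℝ} (hb : ∀ u ∈ Icc s t, HasDerivAt b (b' u) u)
    (hlt : ∀ u ∈ Icc s t, b' u < P.f (b u) (P.Lam (r * u))) (hs : b s ≤ x s) (hst : s ≤ t) :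
    b t ≤ x t := by
  refine image_le_of_deriv_right_lt_deriv_boundary' (f := b) (f' := b')
    (fun u hu => (hb u hu).continuousAt.continuousWithinAt)
    (fun u hu => (hb u (Ico_subset_Icc_self hu)).hasDerivWithinAt) hs hx.continuous.continuousOn
    (fun u _ => (hx u).hasDerivWithinAt) (fun u hu he => ?_) (right_mem_Icc.2 hst)
  rw [← he]
  exact hlt u (Ico_subset_Icc_self hu)

theorem IsSolution.le_of_upper {r : ℝ} {x : ℝ → ℝ} (hx : P.IsSolution r x) {b b' : ℝ → ℝ}
    {s t : ℝ} (hb : ∀ u ∈ Icc s t, HasDerivAt b (b' u) u)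
    (hlt : ∀ u ∈ Icc s t, P.f (b u) (P.Lam (r * u)) < b' u) (hs : x s ≤ b s) (hst : s ≤ t) :
    x t ≤ b t := by
  refine image_le_of_deriv_right_lt_deriv_boundary' hx.continuous.continuousOn
    (fun u _ => (hx u).hasDerivWithinAt) hs
    (fun u hu => (hb u hu).continuousAt.continuousWithinAt)
    (fun u hu => (hb u (Ico_subset_Icc_self hu)).hasDerivWithinAt)
    (fun u hu he => ?_) (right_mem_Icc.2 hst)
  rw [he]
  exact hlt u (Ico_subset_Icc_self hu)

theorem IsSolution.ge_const {r : ℝ} {x : ℝ → ℝ} (hx : P.IsSolution r x) {a s t : ℝ}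
    (ha : ∀ u ∈ Icc s t, 0 < P.f a (P.Lam (r * u))) (hs : a ≤ x s) (hst : s ≤ t) : a ≤ x t :=
  hx.ge_of_lower (b := fun _ => a) (b' := fun _ => 0) (fun u _ => hasDerivAt_const u a) ha hs hst

theorem IsSolution.le_const {r : ℝ} {x : ℝ → ℝ} (hx : P.IsSolution r x) {a s t : ℝ}
    (ha : ∀ u ∈ Icc s t, P.f a (P.Lam (r * u)) < 0) (hs : x s ≤ a) (hst : s ≤ t) : x t ≤ a :=
  hx.le_of_upper (b := fun _ => a) (b' := fun _ => 0) (fun u _ => hasDerivAt_const u a) ha hs hst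

/-- The quantity e^(αu) (y u - x u) is nonincreasing, because f(y) - f(x) ≤ -α (y - x) when x ≤ y.
-/
theorem contraction_aux (h : P.Admissible) {r a b α s t : ℝ} {x y : ℝ → ℝ}
    (hx : P.IsSolution r x) (hy : P.IsSolution r y)
    (hxI : ∀ u ∈ Icc s t, x u ∈ Icc a b) (hyI : ∀ u ∈ Icc s t, y u ∈ Icc a b)
    (hd : ∀ u ∈ Icc s t, ∀ z ∈ Icc a b, P.dfx z (P.Lam (r * u)) ≤ -α)
    (hst : s ≤ t) (hxy : x s ≤ y s) :
    y t - x t ≤ Real.exp (-α * (t - s)) * (y s - x s) := by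
  have hder : ∀ u, HasDerivAt (fun u => Real.exp (α * u) * (y u - x u))
      (Real.exp (α * u) * α * (y u - x u) + Real.exp (α * u) *
        (P.f (y u) (P.Lam (r * u)) - P.f (x u) (P.Lam (r * u)))) u := by
    intro u
    have h1 : HasDerivAt (fun u => Real.exp (α * u)) (Real.exp (α * u) * α) u := by
      simpa using ((hasDerivAt_id u).const_mul α).exp
    exact h1.mul ((hy u).sub (hx u))
  have hanti : AntitoneOn (fun u => Real.exp (α * u) * (y u - x u)) (Icc s t) := by
    refine antitoneOn_of_deriv_nonpos (convex_Icc s t)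
      (fun u _ => (hder u).continuousAt.continuousWithinAt)
      (fun u _ => (hder u).differentiableAt.differentiableWithinAt) fun u hu => ?_
    rw [(hder u).deriv]
    have hu' := interior_subset hu
    have := h.f_sub_le (hd u hu') (hxI u hu') (hyI u hu') (hx.le h hy hxy u)
    have he := Real.exp_pos (α * u)
    nlinarith
  have := hanti ⟨le_rfl, hst⟩ ⟨hst, le_rfl⟩ hst
  simp only at this
  have he : Real.exp (-α * (t - s)) = Real.exp (α * s) / Real.exp (α * t) := by
    rw [← Real.exp_sub]; ring_nf
  rw [he, div_mul_eq_mul_div, le_div_iff₀ (Real.exp_pos _), mul_comm]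
  exact this

theorem contraction (h : P.Admissible) {r a b α s t : ℝ} {x y : ℝ → ℝ}
    (hx : P.IsSolution r x) (hy : P.IsSolution r y)
    (hxI : ∀ u ∈ Icc s t, x u ∈ Icc a b) (hyI : ∀ u ∈ Icc s t, y u ∈ Icc a b)
    (hd : ∀ u ∈ Icc s t, ∀ z ∈ Icc a b, P.dfx z (P.Lam (r * u)) ≤ -α)
    (hst : s ≤ t) : |x t - y t| ≤ Real.exp (-α * (t - s)) * |x s - y s| := by
  rcases le_total (x s) (y s) with hxy | hxy
  · have h1 := hx.le h hy hxy t
    rw [abs_sub_comm, abs_of_nonneg (by linarith), abs_sub_comm, abs_of_nonneg (by linarith)]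
    exact contraction_aux h hx hy hxI hyI hd hst hxy
  · have h1 := hy.le h hx hxy t
    rw [abs_of_nonneg (by linarith), abs_of_nonneg (by linarith)]
    exact contraction_aux h hy hx hyI hxI hd hst hxy

/-! ### The solution emanating from the past stable equilibrium -/

/-- At time T, every solution started on a lies below every solution started on b. The supremum of
the former values separates the two families, and backward comparison keeps the solution through it
in [a, b] for the whole past. -/
theorem exists_trapped (h : P.Admissible) {r a b T : ℝ} (hab : a ≤ b)
    (ha : ∀ t ≤ T, 0 < P.f a (P.Lam (r * t))) (hb : ∀ t ≤ T, P.f b (P.Lam (r * t)) < 0) :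
    ∃ x, P.IsSolution r x ∧ ∀ t ≤ T, x t ∈ Icc a b := by
  have key : ∀ s ≤ T, ∀ s' ≤ T, P.sol r s a T ≤ P.sol r s' b T := by
    intro s hs s' hs'
    rcases le_total s s' with hss | hss
    · refine (isSolution_sol h r s a).le h (isSolution_sol h r s' b) (s := s') ?_ T
      rw [sol_self h]
      exact (isSolution_sol h r s a).le_const (fun u hu => hb u (hu.2.trans hs'))
        (by rwa [sol_self h]) hss
    · refine (isSolution_sol h r s a).le h (isSolution_sol h r s' b) (s := s) ?_ T
      rw [sol_self h]
      exact (isSolution_sol h r s' b).ge_const (fun u hu => ha u (hu.2.trans hs))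
        (by rwa [sol_self h]) hss
  have hbdd : BddAbove ((fun s => P.sol r s a T) '' Iic T) :=
    ⟨P.sol r T b T, by rintro _ ⟨s, hs, rfl⟩; exact key s hs T le_rfl⟩
  have hne : ((fun s => P.sol r s a T) '' Iic T).Nonempty := ⟨_, mem_image_of_mem _ (mem_Iic.2 le_rfl)⟩
  set z := sSup ((fun s => P.sol r s a T) '' Iic T) with hz
  have hx := isSolution_sol h r T z
  refine ⟨P.sol r T z, hx, fun t ht => ⟨?_, ?_⟩⟩
  · have := (isSolution_sol h r t a).le h hx (s := T)
      (by rw [sol_self h r T z]; exact le_csSup hbdd (mem_image_of_mem _ ht)) t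
    rwa [sol_self h] at this
  · have := hx.le h (isSolution_sol h r t b) (s := T)
      (by
        rw [sol_self h r T z]
        refine csSup_le hne ?_
        rintro _ ⟨s, hs, rfl⟩
        exact key s hs t ht) t
    rwa [sol_self h] at this

theorem abs_sub_le_iff_mem_Icc {x p η : ℝ} : |x - p| ≤ η ↔ x ∈ Icc (p - η) (p + η) := by
  rw [abs_le, mem_Icc]
  constructor <;> rintro ⟨h1, h2⟩ <;> constructor <;> linarith

theorem eventually_le_atBot_div {r : ℝ} (hr : 0 < r) (τ : ℝ) : ∀ᶠ t in atBot, r * t ≤ τ :=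
  (tendsto_id.const_mul_atBot hr).eventually (eventually_le_atBot τ)

/-- Uniqueness: contraction from time s bounds the difference at T by e^(-α (T - s)) * 2η0, which
vanishes as s → -∞. Existence: the edges of the tube are inward barriers. The threshold `τ1` is in
slow time r * t, hence the same for all r. -/
theorem exists_xMinus_aux (h : P.Admissible) : ∃ η0 > 0,
    (∀ r > 0, ∀ x y : ℝ → ℝ, P.IsSolution r x → P.IsSolution r y →
      (∀ᶠ t in atBot, |x t - P.Xs P.lm| ≤ η0) → (∀ᶠ t in atBot, |y t - P.Xs P.lm| ≤ η0) → x = y) ∧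
    ∀ η ∈ Ioc 0 η0, ∃ τ1, ∀ r > 0, ∃ x, P.IsSolution r x ∧
      ∀ t, r * t ≤ τ1 → |x t - P.Xs P.lm| ≤ η := by
  obtain ⟨α, hα, η0, hη0, hd, -, -, hs⟩ := h.exists_inward h.lm_mem
  obtain ⟨τ0, hτ0⟩ := eventually_atBot.1 (h.tendsto_Lam_atBot.eventually hd)
  refine ⟨η0, hη0, fun r hr x y hx hy hxη hyη => ?_, fun η hη => ?_⟩
  · obtain ⟨T, hT⟩ := eventually_atBot.1 (hxη.and (hyη.and (eventually_le_atBot_div hr τ0)))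
    refine hx.eq h hy (s := T) ?_
    have hle : ∀ᶠ s in atBot, |x T - y T| ≤ Real.exp (-α * (T - s)) * (2 * η0) := by
      filter_upwards [eventually_le_atBot T] with s hs
      refine (contraction h hx hy (fun u hu => abs_sub_le_iff_mem_Icc.1 (hT u hu.2).1)
        (fun u hu => abs_sub_le_iff_mem_Icc.1 (hT u hu.2).2.1)
        (fun u hu => hτ0 _ (hT u hu.2).2.2) hs).trans ?_
      refine mul_le_mul_of_nonneg_left ?_ (Real.exp_pos _).le
      have h1 := (hT s hs).1
      have h2 := (hT s hs).2.1
      have := abs_sub (x s - P.Xs P.lm) (y s - P.Xs P.lm)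
      rw [sub_sub_sub_cancel_right] at this
      linarith
    have hlim : Tendsto (fun s => Real.exp (-α * (T - s)) * (2 * η0)) atBot (𝓝 0) := by
      have h1 : Tendsto (fun s => -α * (T - s)) atBot atBot := by
        have : Tendsto (fun s => α * s + -(α * T)) atBot atBot :=
          tendsto_atBot_add_const_right _ _ (tendsto_id.const_mul_atBot hα)
        exact this.congr fun s => by ring
      simpa using (Real.tendsto_exp_atBot.comp h1).mul_const (2 * η0)
    have := ge_of_tendsto hlim hle
    exact sub_eq_zero.1 (abs_eq_zero.1 (le_antisymm this (abs_nonneg _)))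
  · obtain ⟨τ1, hτ1⟩ := eventually_atBot.1 (h.tendsto_Lam_atBot.eventually (hs η hη))
    refine ⟨τ1, fun r hr => ?_⟩
    have hT : ∀ t ≤ τ1 / r, r * t ≤ τ1 := fun t ht => by
      rw [le_div_iff₀ hr] at ht; linarith
    obtain ⟨x, hx, hxI⟩ := exists_trapped h (r := r) (a := P.Xs P.lm - η) (b := P.Xs P.lm + η)
      (T := τ1 / r) (by linarith [hη.1]) (fun t ht => (hτ1 _ (hT t ht)).2)
      (fun t ht => (hτ1 _ (hT t ht)).1)
    refine ⟨x, hx, fun t ht => abs_sub_le_iff_mem_Icc.2 (hxI t ?_)⟩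
    rw [le_div_iff₀ hr]; linarith

/-- By uniqueness the solutions trapped in narrower tubes are all the same one, so it converges. -/
theorem xMinus_spec (h : P.Admissible) {r : ℝ} (hr : 0 < r) :
    P.IsSolution r (P.xMinus r) ∧ Tendsto (P.xMinus r) atBot (𝓝 (P.Xs P.lm)) := by
  refine Classical.epsilon_spec
    (p := fun x : ℝ → ℝ => P.IsSolution r x ∧ Tendsto x atBot (𝓝 (P.Xs P.lm))) ?_
  obtain ⟨η0, hη0, huniq, hex⟩ := exists_xMinus_aux h
  obtain ⟨τ1, h1⟩ := hex η0 ⟨hη0, le_rfl⟩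
  obtain ⟨x, hx, hxη⟩ := h1 r hr
  have hxe := (eventually_le_atBot_div hr τ1).mono hxη
  refine ⟨x, hx, ?_⟩
  rw [(nhds_basis_Icc_pos (P.Xs P.lm)).tendsto_right_iff]
  intro e he
  obtain ⟨τ2, h2⟩ := hex (min e η0) ⟨lt_min he hη0, min_le_right _ _⟩
  obtain ⟨y, hy, hyη⟩ := h2 r hr
  have hye := (eventually_le_atBot_div hr τ2).mono hyη
  have hxy := huniq r hr x y hx hy hxe (hye.mono fun t ht => ht.trans (min_le_right _ _))
  rw [hxy]
  filter_upwards [hye] with t ht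
  exact abs_sub_le_iff_mem_Icc.1 (ht.trans (min_le_left _ _))

theorem isSolution_xMinus (h : P.Admissible) {r : ℝ} (hr : 0 < r) : P.IsSolution r (P.xMinus r) :=
  (xMinus_spec h hr).1

theorem tendsto_xMinus (h : P.Admissible) {r : ℝ} (hr : 0 < r) :
    Tendsto (P.xMinus r) atBot (𝓝 (P.Xs P.lm)) :=
  (xMinus_spec h hr).2

theorem eventually_abs_sub_le {x : ℝ → ℝ} {p η : ℝ} {F : Filter ℝ} (hx : Tendsto x F (𝓝 p))
    (hη : 0 < η) : ∀ᶠ t in F, |x t - p| ≤ η := by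
  filter_upwards [(nhds_basis_Icc_pos p).tendsto_right_iff.1 hx η hη] with t ht
  exact abs_sub_le_iff_mem_Icc.2 ht

theorem eq_xMinus_of_eventually (h : P.Admissible) : ∃ η0 > 0, ∀ r > 0, ∀ x : ℝ → ℝ,
    P.IsSolution r x → (∀ᶠ t in atBot, |x t - P.Xs P.lm| ≤ η0) → x = P.xMinus r := by
  obtain ⟨η0, hη0, huniq, -⟩ := exists_xMinus_aux h
  exact ⟨η0, hη0, fun r hr x hx hxe => huniq r hr x _ hx (isSolution_xMinus h hr) hxe
    (eventually_abs_sub_le (tendsto_xMinus h hr) hη0)⟩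

theorem xMinus_near (h : P.Admissible) {η : ℝ} (hη : 0 < η) :
    ∃ τ1, ∀ r > 0, ∀ t, r * t ≤ τ1 → |P.xMinus r t - P.Xs P.lm| ≤ η := by
  obtain ⟨η0, hη0, huniq, hex⟩ := exists_xMinus_aux h
  obtain ⟨τ1, h1⟩ := hex (min η η0) ⟨lt_min hη hη0, min_le_right _ _⟩
  refine ⟨τ1, fun r hr t ht => ?_⟩
  obtain ⟨x, hx, hxη⟩ := h1 r hr
  have hxe := (eventually_le_atBot_div hr τ1).mono hxη
  have hxy := huniq r hr x _ hx (isSolution_xMinus h hr)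
    (hxe.mono fun t ht => ht.trans (min_le_right _ _))
    (eventually_abs_sub_le (tendsto_xMinus h hr) hη0)
  rw [← hxy]
  exact (hxη t ht).trans (min_le_left _ _)

/-- For fixed s, the solution started at `Xs lm` at time s is continuous in r. By contraction it
approximates `xMinus r T` uniformly for r near r0 as s → -∞. -/
theorem continuousAt_xMinus (h : P.Admissible) {r0 : ℝ} (hr0 : 0 < r0) (t : ℝ) :
    ContinuousAt (fun r => P.xMinus r t) r0 := by
  obtain ⟨α, hα, η, hη, hd, -, -, hs⟩ := h.exists_inward h.lm_mem
  obtain ⟨τ1, hτ1⟩ := xMinus_near h hη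
  obtain ⟨τ2, hτ2⟩ := eventually_atBot.1
    (h.tendsto_Lam_atBot.eventually (hd.and (hs η ⟨hη, le_rfl⟩)))
  set τ0 := min (min τ1 τ2) 0 with hτ0
  have hτ0neg : τ0 ≤ 0 := min_le_right _ _
  have hτ01 : τ0 ≤ τ1 := (min_le_left _ _).trans (min_le_left _ _)
  have hτ02 : τ0 ≤ τ2 := (min_le_left _ _).trans (min_le_right _ _)
  -- As τ0 ≤ 0, this T satisfies r * T ≤ τ0 for every r ≥ r0 / 2.
  set T := τ0 / (r0 / 2) with hTdef
  have hT0 : T ≤ 0 := div_nonpos_of_nonpos_of_nonneg hτ0neg (by linarith)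
  have hT : ∀ r ≥ r0 / 2, ∀ u ≤ T, r * u ≤ τ0 := by
    intro r hr u hu
    have h1 : r * u ≤ r * T := mul_le_mul_of_nonneg_left hu (by linarith)
    have h2 : r * T ≤ r0 / 2 * T := mul_le_mul_of_nonpos_right hr hT0
    have h3 : r0 / 2 * T = τ0 := by rw [hTdef]; field_simp
    linarith
  have hnear : ∀ᶠ r in 𝓝 r0, r0 / 2 ≤ r := (eventually_gt_nhds (by linarith)).mono fun _ => le_of_lt
  refine continuousAt_solution h t (s := T)
    ((eventually_gt_nhds hr0).mono fun r hr => isSolution_xMinus h hr) ?_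
  refine continuousAt_of_locally_uniform_approx_of_continuousAt fun u hu => ?_
  obtain ⟨e, he, hu⟩ := Metric.mem_uniformity_dist.1 hu
  have hlim : Tendsto (fun s => Real.exp (-α * (T - s)) * η) atBot (𝓝 0) := by
    have h1 : Tendsto (fun s => -α * (T - s)) atBot atBot := by
      have : Tendsto (fun s => α * s + -(α * T)) atBot atBot :=
        tendsto_atBot_add_const_right _ _ (tendsto_id.const_mul_atBot hα)
      exact this.congr fun s => by ring
    simpa using (Real.tendsto_exp_atBot.comp h1).mul_const η
  obtain ⟨s, hse, hsT⟩ := ((hlim.eventually (gt_mem_nhds he)).and (eventually_le_atBot T)).exists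
  refine ⟨_, hnear, fun r => P.sol r s (P.Xs P.lm) T, ?_, fun r hr => hu ?_⟩
  · refine continuousAt_solution h (x := fun r => P.sol r s (P.Xs P.lm)) (s := s) T
      (Eventually.of_forall fun r => isSolution_sol h r s _) ?_
    simp only [sol_self h]
    exact continuousAt_const
  · have hr' : r0 / 2 ≤ r := hr
    have hrpos : 0 < r := by linarith
    have hsol := isSolution_sol h r s (P.Xs P.lm)
    rw [Real.dist_eq]
    refine (contraction h (a := P.Xs P.lm - η) (b := P.Xs P.lm + η) (α := α)
      (isSolution_xMinus h hrpos) hsol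
      (fun u hu => abs_sub_le_iff_mem_Icc.1 (hτ1 r hrpos u ((hT r hr' u hu.2).trans hτ01)))
      (fun u hu => ⟨?_, ?_⟩) (fun u hu => (hτ2 _ ((hT r hr' u hu.2).trans hτ02)).1) hsT).trans_lt ?_
    · exact hsol.ge_const (fun v hv => (hτ2 _ ((hT r hr' v (hv.2.trans hu.2)).trans hτ02)).2.2)
        (by rw [sol_self h]; linarith) hu.1
    · exact hsol.le_const (fun v hv => (hτ2 _ ((hT r hr' v (hv.2.trans hu.2)).trans hτ02)).2.1)
        (by rw [sol_self h]; linarith) hu.1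
    · refine lt_of_le_of_lt (mul_le_mul_of_nonneg_left ?_ (Real.exp_pos _).le) hse
      rw [sol_self h]
      exact hτ1 r hrpos s ((hT r hr' s hsT).trans hτ01)

/-! ### The solution converging to the future unstable equilibrium -/

/-- Both sides come from `Classical.epsilon`; they agree because only one solution of the reversed
problem has the required limit. -/
theorem xPlus_eq (h : P.Admissible) {r : ℝ} (hr : 0 < r) :
    P.xPlus r = fun t => -P.rev.xMinus r (-t) := by
  have hlp : P.rev.Xs P.rev.lm = -P.Xu P.lp := by simp [rev]
  have hspec : P.IsSolution r (P.xPlus r) ∧ Tendsto (P.xPlus r) atTop (𝓝 (P.Xu P.lp)) := by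
    refine Classical.epsilon_spec
      (p := fun x : ℝ → ℝ => P.IsSolution r x ∧ Tendsto x atTop (𝓝 (P.Xu P.lp)))
      ⟨fun t => -P.rev.xMinus r (-t), isSolution_of_rev (isSolution_xMinus h.rev hr), ?_⟩
    have := ((tendsto_xMinus h.rev hr).comp tendsto_neg_atTop_atBot).neg
    rw [hlp, neg_neg] at this
    exact this
  obtain ⟨η0, hη0, huniq⟩ := eq_xMinus_of_eventually h.rev
  have ht : Tendsto (fun t => -P.xPlus r (-t)) atBot (𝓝 (P.rev.Xs P.rev.lm)) := by
    rw [hlp]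
    exact (hspec.2.comp tendsto_neg_atBot_atTop).neg
  have := huniq r hr _ hspec.1.rev (eventually_abs_sub_le ht hη0)
  ext t
  rw [← this]
  simp

theorem rev_xMinus (h : P.Admissible) {r : ℝ} (hr : 0 < r) (t : ℝ) :
    P.rev.xMinus r t = -P.xPlus r (-t) := by
  simp [xPlus_eq h hr]

theorem isSolution_xPlus (h : P.Admissible) {r : ℝ} (hr : 0 < r) : P.IsSolution r (P.xPlus r) := by
  rw [xPlus_eq h hr]
  exact isSolution_of_rev (isSolution_xMinus h.rev hr)

theorem tendsto_xPlus (h : P.Admissible) {r : ℝ} (hr : 0 < r) :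
    Tendsto (P.xPlus r) atTop (𝓝 (P.Xu P.lp)) := by
  rw [xPlus_eq h hr]
  have := ((tendsto_xMinus h.rev hr).comp tendsto_neg_atTop_atBot).neg
  simpa [rev] using! this

theorem continuousAt_xPlus (h : P.Admissible) {r0 : ℝ} (hr0 : 0 < r0) (t : ℝ) :
    ContinuousAt (fun r => P.xPlus r t) r0 := by
  refine (continuousAt_xMinus h.rev hr0 (-t)).neg.congr ?_
  filter_upwards [eventually_gt_nhds hr0] with r hr
  simp [xPlus_eq h hr]

theorem eq_xPlus_of_eventually (h : P.Admissible) : ∃ η0 > 0, ∀ r > 0, ∀ x : ℝ → ℝ,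
    P.IsSolution r x → (∀ᶠ t in atTop, |x t - P.Xu P.lp| ≤ η0) → x = P.xPlus r := by
  obtain ⟨η0, hη0, huniq⟩ := eq_xMinus_of_eventually h.rev
  refine ⟨η0, hη0, fun r hr x hx hxe => ?_⟩
  have := huniq r hr _ hx.rev (by
    filter_upwards [tendsto_neg_atBot_atTop.eventually hxe] with t ht
    rw [abs_sub_comm]
    simpa [rev, add_comm, sub_eq_add_neg] using ht)
  ext t
  rw [xPlus_eq h hr, ← this]
  simp

end RateProblem

/-! ### Calculus of functions that are flat at both ends of time -/

/-- `g` is `m` times differentiable, has the limits `a` at `-∞` and `b` at `∞`, and its derivatives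
of orders `1, …, m` tend to zero at both ends. -/
def FlatAtEnds : ℕ → (ℝ → ℝ) → ℝ → ℝ → Prop
  | 0, g, a, b => Continuous g ∧ Tendsto g atBot (𝓝 a) ∧ Tendsto g atTop (𝓝 b)
  | m + 1, g, a, b => (Differentiable ℝ g ∧ Tendsto g atBot (𝓝 a) ∧ Tendsto g atTop (𝓝 b)) ∧
      FlatAtEnds m (deriv g) 0 0

namespace FlatAtEnds

variable {m : ℕ} {g k : ℝ → ℝ} {a b c d : ℝ}

theorem zero (h : FlatAtEnds m g a b) : FlatAtEnds 0 g a b := by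
  cases m with
  | zero => exact h
  | succ m => exact ⟨h.1.1.continuous, h.1.2⟩

theorem of_succ (h : FlatAtEnds (m + 1) g a b) : FlatAtEnds m g a b := by
  induction m generalizing g a b with
  | zero => exact h.zero
  | succ m ih => exact ⟨h.1, ih h.2⟩

theorem of_le {m' : ℕ} (h : FlatAtEnds m g a b) (hm : m' ≤ m) : FlatAtEnds m' g a b := by
  induction m, hm using Nat.le_induction with
  | base => exact h
  | succ m _ ih => exact ih h.of_succ

theorem const (m : ℕ) (a : ℝ) : FlatAtEnds m (fun _ => a) a a := by
  induction m generalizing a with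
  | zero => exact ⟨continuous_const, tendsto_const_nhds, tendsto_const_nhds⟩
  | succ m ih =>
    refine ⟨⟨differentiable_const _, tendsto_const_nhds, tendsto_const_nhds⟩, ?_⟩
    have : deriv (fun _ : ℝ => a) = fun _ => 0 := by ext; simp
    rw [this]
    exact ih 0

theorem add (h : FlatAtEnds m g a b) (h' : FlatAtEnds m k c d) :
    FlatAtEnds m (fun τ => g τ + k τ) (a + c) (b + d) := by
  induction m generalizing g k a b c d with
  | zero => exact ⟨h.1.add h'.1, h.2.1.add h'.2.1, h.2.2.add h'.2.2⟩
  | succ m ih =>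
    refine ⟨⟨h.1.1.add h'.1.1, h.1.2.1.add h'.1.2.1, h.1.2.2.add h'.1.2.2⟩, ?_⟩
    have : deriv (fun τ => g τ + k τ) = fun τ => deriv g τ + deriv k τ := by
      ext τ; exact deriv_fun_add (h.1.1 τ) (h'.1.1 τ)
    rw [this]
    simpa using ih h.2 h'.2

theorem mul (h : FlatAtEnds m g a b) (h' : FlatAtEnds m k c d) :
    FlatAtEnds m (fun τ => g τ * k τ) (a * c) (b * d) := by
  induction m generalizing g k a b c d with
  | zero => exact ⟨h.1.mul h'.1, h.2.1.mul h'.2.1, h.2.2.mul h'.2.2⟩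
  | succ m ih =>
    refine ⟨⟨h.1.1.mul h'.1.1, h.1.2.1.mul h'.1.2.1, h.1.2.2.mul h'.1.2.2⟩, ?_⟩
    have : deriv (fun τ => g τ * k τ) = fun τ => deriv g τ * k τ + g τ * deriv k τ := by
      ext τ; exact deriv_fun_mul (h.1.1 τ) (h'.1.1 τ)
    rw [this]
    simpa using (ih h.2 h'.of_succ).add (ih h.of_succ h'.2)

theorem neg (h : FlatAtEnds m g a b) : FlatAtEnds m (fun τ => -g τ) (-a) (-b) := by
  simpa using (const m (-1)).mul h

theorem sub (h : FlatAtEnds m g a b) (h' : FlatAtEnds m k c d) :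
    FlatAtEnds m (fun τ => g τ - k τ) (a - c) (b - d) := by
  simpa [sub_eq_add_neg] using h.add h'.neg

theorem inv (h : FlatAtEnds m g a b) (hg : ∀ τ, g τ ≠ 0) (ha : a ≠ 0) (hb : b ≠ 0) :
    FlatAtEnds m (fun τ => (g τ)⁻¹) a⁻¹ b⁻¹ := by
  induction m with
  | zero => exact ⟨h.1.inv₀ hg, h.2.1.inv₀ ha, h.2.2.inv₀ hb⟩
  | succ m ih =>
    have ih' := ih h.of_succ
    refine ⟨⟨h.1.1.inv hg, ih'.zero.2⟩, ?_⟩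
    have : deriv (fun τ => (g τ)⁻¹) = fun τ => -(deriv g τ * ((g τ)⁻¹ * (g τ)⁻¹)) := by
      ext τ
      rw [((h.1.1 τ).hasDerivAt.fun_inv (hg τ)).deriv]
      field_simp
    rw [this]
    simpa using (h.2.mul (ih'.mul ih')).neg

theorem div (h : FlatAtEnds m g a b) (h' : FlatAtEnds m k c d) (hk : ∀ τ, k τ ≠ 0) (hc : c ≠ 0)
    (hd : d ≠ 0) : FlatAtEnds m (fun τ => g τ / k τ) (a / c) (b / d) := by
  simpa [div_eq_mul_inv] using h.mul (h'.inv hk hc hd)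

/-- The induction treats all smooth F at once, since the chain rule replaces F by its partial
derivatives. -/
theorem comp_prod {F : ℝ × ℝ → ℝ} (hF : ContDiff ℝ ∞ F) (h : FlatAtEnds m g a b)
    (h' : FlatAtEnds m k c d) : FlatAtEnds m (fun τ => F (g τ, k τ)) (F (a, c)) (F (b, d)) := by
  induction m generalizing F with
  | zero =>
    exact ⟨hF.continuous.comp (h.1.prodMk h'.1),
      (hF.continuous.tendsto (a, c)).comp (h.2.1.prodMk_nhds h'.2.1),
      (hF.continuous.tendsto (b, d)).comp (h.2.2.prodMk_nhds h'.2.2)⟩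
  | succ m ih =>
    have hd : Differentiable ℝ F := hF.differentiable (by simp)
    refine ⟨⟨hd.comp (h.1.1.prodMk h'.1.1), (ih hF h.of_succ h'.of_succ).zero.2⟩, ?_⟩
    have hpart : ∀ v : ℝ × ℝ, ContDiff ℝ ∞ fun p => fderiv ℝ F p v := fun v =>
      (hF.fderiv_right (m := ∞) (by simp)).clm_apply contDiff_const
    have : deriv (fun τ => F (g τ, k τ)) = fun τ =>
        fderiv ℝ F (g τ, k τ) (1, 0) * deriv g τ + fderiv ℝ F (g τ, k τ) (0, 1) * deriv k τ := by
      ext τ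
      have h1 := ((hd (g τ, k τ)).hasFDerivAt.comp_hasDerivAt τ
        ((h.1.1 τ).hasDerivAt.prodMk (h'.1.1 τ).hasDerivAt)).deriv
      have h2 : ((deriv g τ, deriv k τ) : ℝ × ℝ) =
          deriv g τ • ((1 : ℝ), (0 : ℝ)) + deriv k τ • ((0 : ℝ), (1 : ℝ)) := by simp
      rw [h2, map_add, map_smul, map_smul] at h1
      simpa [mul_comm, Function.comp_def] using h1
    rw [this]
    simpa using ((ih (hpart (1, 0)) h.of_succ h'.of_succ).mul h.2).add
      ((ih (hpart (0, 1)) h.of_succ h'.of_succ).mul h'.2)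

theorem sum {ι : Type*} (s : Finset ι) {g : ι → ℝ → ℝ} {a b : ι → ℝ}
    (h : ∀ i ∈ s, FlatAtEnds m (g i) (a i) (b i)) :
    FlatAtEnds m (fun τ => ∑ i ∈ s, g i τ) (∑ i ∈ s, a i) (∑ i ∈ s, b i) := by
  classical
  induction s using Finset.induction_on with
  | empty => simpa using const m 0
  | insert i s hi ih =>
    simp only [Finset.sum_insert hi]
    exact (h i (Finset.mem_insert_self i s)).add
      (ih fun j hj => h j (Finset.mem_insert_of_mem hj))

theorem prod {ι : Type*} (s : Finset ι) {g : ι → ℝ → ℝ} {a b : ι → ℝ}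
    (h : ∀ i ∈ s, FlatAtEnds m (g i) (a i) (b i)) :
    FlatAtEnds m (fun τ => ∏ i ∈ s, g i τ) (∏ i ∈ s, a i) (∏ i ∈ s, b i) := by
  classical
  induction s using Finset.induction_on with
  | empty => simpa using const m 1
  | insert i s hi ih =>
    simp only [Finset.prod_insert hi]
    exact (h i (Finset.mem_insert_self i s)).mul
      (ih fun j hj => h j (Finset.mem_insert_of_mem hj))

theorem of_iteratedDeriv (hg : ContDiff ℝ m g) (ha : Tendsto g atBot (𝓝 a))
    (hb : Tendsto g atTop (𝓝 b))
    (hbot : ∀ i ∈ Finset.Icc 1 m, Tendsto (iteratedDeriv i g) atBot (𝓝 0))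
    (htop : ∀ i ∈ Finset.Icc 1 m, Tendsto (iteratedDeriv i g) atTop (𝓝 0)) :
    FlatAtEnds m g a b := by
  induction m generalizing g a b with
  | zero => exact ⟨hg.continuous, ha, hb⟩
  | succ m ih =>
    refine ⟨⟨hg.differentiable (by simp), ha, hb⟩, ?_⟩
    have h1 : (1 : ℕ) ∈ Finset.Icc 1 (m + 1) := by simp
    have hd : ContDiff ℝ m (deriv g) := by
      have : ContDiff ℝ ((m : WithTop ℕ∞) + 1) g := by exact_mod_cast hg
      exact (contDiff_succ_iff_deriv.1 this).2.2
    refine ih hd (by simpa using hbot 1 h1) (by simpa using htop 1 h1) (fun i hi => ?_)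
      (fun i hi => ?_)
    all_goals
      rw [← iteratedDeriv_succ']
      rw [Finset.mem_Icc] at hi
    · exact hbot (i + 1) (by simp only [Finset.mem_Icc]; omega)
    · exact htop (i + 1) (by simp only [Finset.mem_Icc]; omega)

theorem exists_bound (h : FlatAtEnds m g a b) : ∃ C, 0 ≤ C ∧ ∀ τ, |g τ| ≤ C := by
  obtain ⟨hc, h1, h2⟩ := h.zero
  obtain ⟨A, hA⟩ := eventually_atBot.1 (h1.abs.eventually (gt_mem_nhds (lt_add_one |a|)))
  obtain ⟨B, hB⟩ := eventually_atTop.1 (h2.abs.eventually (gt_mem_nhds (lt_add_one |b|)))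
  obtain ⟨C, hC⟩ := (isCompact_Icc (a := A) (b := B)).exists_bound_of_continuousOn hc.continuousOn
  refine ⟨max C (max (|a| + 1) (|b| + 1)), by positivity, fun τ => ?_⟩
  rcases le_total τ A with hτ | hτ
  · exact (hA τ hτ).le.trans ((le_max_left _ _).trans (le_max_right _ _))
  · rcases le_total B τ with hτ' | hτ'
    · exact (hB τ hτ').le.trans ((le_max_right _ _).trans (le_max_right _ _))
    · exact (hC τ ⟨hτ, hτ'⟩).trans (le_max_left _ _)

end FlatAtEnds

/-- Continuity of g forces it onto the branch given by the implicit function theorem, which upgrades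
a merely continuous solution curve to a differentiable one. -/
theorem HasStrictFDerivAt.differentiableAt_of_implicit {F : ℝ × ℝ → ℝ} {F' : ℝ × ℝ →L[ℝ] ℝ}
    {g k : ℝ → ℝ} {τ : ℝ} (hF : HasStrictFDerivAt F F' (k τ, g τ)) (h1 : F' (0, 1) ≠ 0)
    (hg : ContinuousAt g τ) (hk : DifferentiableAt ℝ k τ) (h0 : ∀ u, F (k u, g u) = F (k τ, g τ)) :
    DifferentiableAt ℝ g τ := by
  have hinv : (F' ∘L .inr ℝ ℝ ℝ).IsInvertible := by
    refine ⟨ContinuousLinearEquiv.unitsEquivAut ℝ (Units.mk0 _ h1), ?_⟩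
    ext
    simp
  have hev := hF.eventually_apply_eq_iff_implicitFunctionOfProdDomain hinv
  have hst := hF.hasStrictFDerivAt_implicitFunctionOfProdDomain hinv
  have ht : Tendsto (fun u => (k u, g u)) (𝓝 τ) (𝓝 (k τ, g τ)) :=
    hk.continuousAt.prodMk hg
  refine (hst.differentiableAt.comp τ hk).congr_of_eventuallyEq ?_
  filter_upwards [ht.eventually hev] with u hu
  exact (hu.1 (h0 u)).symm

/-! ### Regularity and limits of the formal series coefficients -/

namespace RateProblem

variable {P : RateProblem}

theorem contDiff_iteratedDeriv_f (hf : ContDiff ℝ ∞ (Function.uncurry P.f)) (j : ℕ) :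
    ContDiff ℝ ∞ fun p : ℝ × ℝ => iteratedDeriv j (fun y => P.f y p.2) p.1 := by
  induction j with
  | zero =>
    simp only [iteratedDeriv_zero]
    exact hf
  | succ j ih =>
    have hd : Differentiable ℝ fun p : ℝ × ℝ => iteratedDeriv j (fun y => P.f y p.2) p.1 :=
      ih.differentiable (by simp)
    have : (fun p : ℝ × ℝ => iteratedDeriv (j + 1) (fun y => P.f y p.2) p.1) = fun p =>
        fderiv ℝ (fun p : ℝ × ℝ => iteratedDeriv j (fun y => P.f y p.2) p.1) p (1, 0) := by
      ext p
      rw [iteratedDeriv_succ]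
      have h1 : HasDerivAt (fun y : ℝ => (y, p.2)) ((1 : ℝ), (0 : ℝ)) p.1 :=
        (hasDerivAt_id p.1).prodMk (hasDerivAt_const p.1 p.2)
      exact ((hd p).hasFDerivAt.comp_hasDerivAt p.1 h1).deriv
    rw [this]
    exact (ih.fderiv_right (m := ∞) (by simp)).clm_apply contDiff_const

theorem contDiff_dfx (hf : ContDiff ℝ ∞ (Function.uncurry P.f)) :
    ContDiff ℝ ∞ fun p : ℝ × ℝ => P.dfx p.1 p.2 := by
  simpa [dfx] using contDiff_iteratedDeriv_f hf 1

/-- After the implicit function theorem gives one derivative, the identity (X ∘ Λ)' = -f_λ Λ' / f_x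
bootstraps to order m. The factor Λ' makes the derivatives vanish at both ends. -/
theorem flat_curve (h : P.Admissible) {X : ℝ → ℝ} (hX : P.IsEquilibriumCurve X) {m : ℕ}
    (hL : FlatAtEnds m P.Lam P.lm P.lp) :
    FlatAtEnds m (fun τ => X (P.Lam τ)) (X P.lm) (X P.lp) := by
  have hcont : ∀ l ∈ Icc P.lm P.lp, ∀ F : Filter ℝ, Tendsto P.Lam F (𝓝 l) →
      Tendsto (fun τ => X (P.Lam τ)) F (𝓝 (X l)) := fun l hl F hF =>
    (hX.1 l hl).tendsto.comp (tendsto_nhdsWithin_iff.2 ⟨hF, Eventually.of_forall h.Lam_mem⟩)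
  have h00 : FlatAtEnds 0 (fun τ => X (P.Lam τ)) (X P.lm) (X P.lp) :=
    ⟨continuous_iff_continuousAt.2 fun τ =>
      hcont _ (h.Lam_mem τ) _ h.continuous_Lam.continuousAt,
      hcont _ h.lm_mem _ h.tendsto_Lam_atBot, hcont _ h.lp_mem _ h.tendsto_Lam_atTop⟩
  induction m with
  | zero => exact h00
  | succ m ih =>
    have ih' := ih hL.of_succ
    have hfd : Differentiable ℝ (Function.uncurry P.f) := h.contDiff_f.differentiable (by simp)
    have hdiff : Differentiable ℝ fun τ => X (P.Lam τ) := by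
      intro τ
      have hs : ContDiff ℝ ∞ fun p : ℝ × ℝ => P.f p.2 p.1 :=
        h.contDiff_f.comp (contDiff_snd.prodMk contDiff_fst)
      refine ((hs.contDiffAt.hasStrictFDerivAt (by simp)) :
        HasStrictFDerivAt (fun p : ℝ × ℝ => P.f p.2 p.1) _ (P.Lam τ, X (P.Lam τ)))
        |>.differentiableAt_of_implicit (g := fun τ => X (P.Lam τ)) (k := P.Lam) ?_
        h00.1.continuousAt (hL.1.1 τ) fun u => ?_
      · have h1 : HasDerivAt (fun y : ℝ => (P.Lam τ, y)) ((0 : ℝ), (1 : ℝ)) (X (P.Lam τ)) :=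
          (hasDerivAt_const _ _).prodMk (hasDerivAt_id _)
        have h2 := ((hs.differentiable (by simp) (P.Lam τ, X (P.Lam τ))).hasFDerivAt.comp_hasDerivAt
          _ h1).deriv
        rw [← h2]
        exact (hX.2 _ (h.Lam_mem τ)).2
      · simp only
        rw [(hX.2 _ (h.Lam_mem τ)).1, (hX.2 _ (h.Lam_mem u)).1]
    refine ⟨⟨hdiff, h00.2⟩, ?_⟩
    have hder : deriv (fun τ => X (P.Lam τ)) = fun τ =>
        -(fderiv ℝ (Function.uncurry P.f) (X (P.Lam τ), P.Lam τ) (0, 1) * deriv P.Lam τ) /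
          P.dfx (X (P.Lam τ)) (P.Lam τ) := by
      ext τ
      have h1 := (hfd (X (P.Lam τ), P.Lam τ)).hasFDerivAt.comp_hasDerivAt τ
        ((hdiff τ).hasDerivAt.prodMk (hL.1.1 τ).hasDerivAt)
      have h2 : Function.uncurry P.f ∘ (fun τ => (X (P.Lam τ), P.Lam τ)) = fun _ => 0 := by
        ext u; exact (hX.2 _ (h.Lam_mem u)).1
      rw [h2] at h1
      have h3 := h1.unique (hasDerivAt_const τ (0 : ℝ))
      have h4 : ((deriv (fun τ => X (P.Lam τ)) τ, deriv P.Lam τ) : ℝ × ℝ) =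
          deriv (fun τ => X (P.Lam τ)) τ • ((1 : ℝ), (0 : ℝ)) +
            deriv P.Lam τ • ((0 : ℝ), (1 : ℝ)) := by simp
      rw [h4, map_add, map_smul, map_smul, ← h.dfx_eq, smul_eq_mul, smul_eq_mul] at h3
      rw [eq_div_iff (hX.2 _ (h.Lam_mem τ)).2]
      linarith
    rw [hder]
    have hpart : ContDiff ℝ ∞ fun p => fderiv ℝ (Function.uncurry P.f) p (0, 1) :=
      (h.contDiff_f.fderiv_right (m := ∞) (by simp)).clm_apply contDiff_const
    have := (((FlatAtEnds.comp_prod hpart ih' hL.of_succ).mul hL.2).neg).div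
      (FlatAtEnds.comp_prod (contDiff_dfx h.contDiff_f) ih' hL.of_succ)
      (fun τ => (hX.2 _ (h.Lam_mem τ)).2) (hX.2 _ h.lm_mem).2 (hX.2 _ h.lp_mem).2
    simpa using this

theorem seriesCoeff_succ (X : ℝ → ℝ) (i : ℕ) :
    P.seriesCoeff X (i + 1) = fun τ =>
      (deriv (P.seriesCoeff X i) τ -
        ∑ c : {c : Composition (i + 1) // 2 ≤ c.length},
          iteratedDeriv c.1.length (fun y => P.f y (P.Lam τ)) (X (P.Lam τ)) / (c.1.length ! : ℝ) *
            ∏ l : Fin c.1.length, P.seriesCoeff X (c.1.blocksFun l) τ) /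
        P.dfx (X (P.Lam τ)) (P.Lam τ) := by
  rw [seriesCoeff]

theorem seriesCoeff_zero (X : ℝ → ℝ) : P.seriesCoeff X 0 = fun τ => X (P.Lam τ) := by
  rw [seriesCoeff]

/-- Each new coefficient costs one derivative of Λ. Its limits are 0 because the derivative of the
previous coefficient tends to 0, and every product has factors of lower positive index, which vanish
at the ends by induction. -/
theorem flat_seriesCoeff_succ (h : P.Admissible) {X : ℝ → ℝ} (hX : P.IsEquilibriumCurve X) {m : ℕ}
    (hL : FlatAtEnds m P.Lam P.lm P.lp) (i : ℕ) (hi : i + 1 ≤ m) :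
    FlatAtEnds (m - (i + 1)) (P.seriesCoeff X (i + 1)) 0 0 := by
  induction i using Nat.strong_induction_on with
  | _ i ih =>
    have h0 := flat_curve h hX hL
    have hder : FlatAtEnds (m - (i + 1)) (deriv (P.seriesCoeff X i)) 0 0 := by
      have hm : m - i = (m - (i + 1)) + 1 := by omega
      cases i with
      | zero =>
        rw [seriesCoeff_zero]
        have : FlatAtEnds (m - (0 + 1) + 1) (fun τ => X (P.Lam τ)) (X P.lm) (X P.lp) :=
          h0.of_le (by omega)
        exact this.2
      | succ j =>
        have := ih j (by omega) (by omega)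
        rw [hm] at this
        exact this.2
    have hle : m - (i + 1) ≤ m := Nat.sub_le _ _
    rw [seriesCoeff_succ]
    have hprod : ∀ c : {c : Composition (i + 1) // 2 ≤ c.length}, FlatAtEnds (m - (i + 1))
        (fun τ => ∏ l : Fin c.1.length, P.seriesCoeff X (c.1.blocksFun l) τ) 0 0 := by
      intro c
      have hl : ∀ l ∈ (Finset.univ : Finset (Fin c.1.length)),
          FlatAtEnds (m - (i + 1)) (P.seriesCoeff X (c.1.blocksFun l)) 0 0 := by
        intro l _
        have h1 := blocksFun_lt_of_two_le_length c.1 c.2 l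
        obtain ⟨k, hk⟩ : ∃ k, c.1.blocksFun l = k + 1 :=
          ⟨c.1.blocksFun l - 1, by have := c.1.one_le_blocksFun l; omega⟩
        rw [hk]
        exact (ih k (by omega) (by omega)).of_le (by omega)
      have := FlatAtEnds.prod Finset.univ hl
      have hcne : Fintype.card (Fin c.1.length) ≠ 0 := by
        have := c.2
        simp only [Fintype.card_fin]; omega
      simpa [Finset.prod_const, hcne] using this
    have hsum := FlatAtEnds.sum (m := m - (i + 1)) Finset.univ fun c _ =>
      (((FlatAtEnds.comp_prod (contDiff_iteratedDeriv_f h.contDiff_f c.1.length) (h0.of_le hle)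
        (hL.of_le hle)).div (FlatAtEnds.const _ (c.1.length ! : ℝ)) (fun _ => by positivity)
        (by positivity) (by positivity)).mul (hprod c))
    have := (hder.sub hsum).div
      (FlatAtEnds.comp_prod (contDiff_dfx h.contDiff_f) (h0.of_le hle) (hL.of_le hle))
      (fun τ => (hX.2 _ (h.Lam_mem τ)).2) (hX.2 _ h.lm_mem).2 (hX.2 _ h.lp_mem).2
    simpa using this

/-! ### From the hypotheses to the reversible assumptions -/

/-- The negative derivative at `Xs` makes f positive just below it; a nonpositive value further down
would create an equilibrium in the gap. -/
theorem H1.pos_between {d0 : ℝ} (h0 : P.H0) (h1 : P.H1 d0)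
    (hf : ContDiff ℝ ∞ (Function.uncurry P.f)) {l : ℝ} (hl : l ∈ Icc P.lm P.lp) {x : ℝ}
    (hx : x ∈ Ioo (P.Xu l) (P.Xs l)) : 0 < P.f x l := by
  by_contra! hcon
  have hd := hasDerivAt_f_left hf (P.Xs l) l
  rw [hasDerivAt_iff_tendsto_slope] at hd
  have hneg := (hd.eventually (gt_mem_nhds (h0.stable_Xs l hl))).filter_mono
    (nhdsWithin_mono (P.Xs l) (fun y (hy : y < P.Xs l) => ne_of_lt hy) : 𝓝[<] (P.Xs l) ≤ _)
  obtain ⟨y, hy1, hy2⟩ := (hneg.and (Ioo_mem_nhdsLT hx.2)).exists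
  have hpos : 0 < P.f y l := by
    rw [slope_def_field, (h0.curve_Xs.2 l hl).1, sub_zero] at hy1
    by_contra! hc
    have := div_nonneg_of_nonpos hc (by linarith [hy2.2] : y - P.Xs l ≤ 0)
    linarith
  have hc : ContinuousOn (fun y => P.f y l) (Icc x y) :=
    fun z _ => (hasDerivAt_f_left hf z l).continuousAt.continuousWithinAt
  obtain ⟨z, hz, hz0⟩ := intermediate_value_Icc hy2.1.le hc ⟨hcon, hpos.le⟩
  exact h1.no_equilibria_between l hl z ⟨hx.1.trans_le hz.1, hz.2.trans_lt hy2.2⟩ hz0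

theorem H0.Lam_mem (h0 : P.H0) (τ : ℝ) : P.Lam τ ∈ Icc P.lm P.lp :=
  ⟨h0.strictMono_Lam.monotone.le_of_tendsto h0.tendsto_Lam_atBot τ,
    h0.strictMono_Lam.monotone.ge_of_tendsto h0.tendsto_Lam_atTop τ⟩

/-- Along `Xu` the x-derivative is continuous and never zero, so its sign at `lp` propagates to all
parameters. -/
theorem H1.unstable {d0 : ℝ} (h1 : P.H1 d0)
    (hf : ContDiff ℝ ∞ (Function.uncurry P.f)) {l : ℝ} (hl : l ∈ Icc P.lm P.lp) :
    0 < P.dfx (P.Xu l) l := by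
  by_contra! hcon
  have hc : ContinuousOn (fun l => P.dfx (P.Xu l) l) (Icc P.lm P.lp) :=
    (contDiff_dfx hf).continuous.comp_continuousOn (h1.curve_Xu.1.prodMk continuousOn_id)
  have hsub : Icc l P.lp ⊆ Icc P.lm P.lp := Icc_subset_Icc_left hl.1
  obtain ⟨z, hz, hz0⟩ := intermediate_value_Icc hl.2 (hc.mono hsub) ⟨hcon, h1.unstable_Xu.le⟩
  exact (h1.curve_Xu.2 z (hsub hz)).2 hz0

theorem H1.admissible {d0 : ℝ} (h0 : P.H0) (h1 : P.H1 d0)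
    (hf : ContDiff ℝ ∞ (Function.uncurry P.f)) : P.Admissible where
  contDiff_f := hf
  bounded_f := h0.bounded_f
  continuous_Lam := h0.contDiff_Lam.continuous
  Lam_mem := h0.Lam_mem
  tendsto_Lam_atBot := h0.tendsto_Lam_atBot
  tendsto_Lam_atTop := h0.tendsto_Lam_atTop
  lm_le_lp := (h0.Lam_mem 0).1.trans (h0.Lam_mem 0).2
  curve_Xs := h0.curve_Xs
  curve_Xu := h1.curve_Xu
  stable_Xs := h0.stable_Xs
  unstable_Xu := fun _ hl => h1.unstable hf hl
  Xu_lt_Xs := h1.Xu_lt_Xs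
  pos_between := fun _ hl _ hx => h1.pos_between h0 hf hl hx

/-! ### Truncated series as guides -/

/-- A family of curves `σ r` from which the stable equilibria can be approximated: `σ r` is close
to `Xs (Λ (r t))` for small `r`, and flat near the past limit `Xs lm`, uniformly in `r ≤ R`. -/
structure IsGuide (P : RateProblem) (R : ℝ) (σ : ℝ → ℝ → ℝ) : Prop where
  continuous : ∀ t, Continuous fun r => σ r t
  near : ∀ η > 0, ∃ τ1, ∀ r ∈ Ioc 0 R, ∀ t, r * t ≤ τ1 → |σ r t - P.Xs P.lm| ≤ η
  deriv : ∃ σ' : ℝ → ℝ → ℝ, (∀ r t, HasDerivAt (σ r) (σ' r t) t) ∧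
    ∀ η > 0, ∃ τ1, ∀ r ∈ Ioc 0 R, ∀ t, r * t ≤ τ1 → |σ' r t| ≤ η
  slow : ∀ η > 0, ∃ r1 > 0, ∀ r ∈ Ioo 0 r1, ∀ t, |σ r t - P.Xs (P.Lam (r * t))| ≤ η
  curve : ∃ D : ℝ → ℝ, ∃ C, ∀ τ, HasDerivAt (fun τ => P.Xs (P.Lam τ)) (D τ) τ ∧ |D τ| ≤ C

/-- Since Λ has n + 1 flat derivatives, at least one is left for each coefficient up to a_n; this is
what controls the slope of S_n. -/
theorem flat_seriesCoeff (h : P.Admissible) {X : ℝ → ℝ} (hX : P.IsEquilibriumCurve X) {n : ℕ}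
    (hL : FlatAtEnds (n + 1) P.Lam P.lm P.lp) (i : ℕ) (hi : i ≤ n) :
    FlatAtEnds 1 (P.seriesCoeff X i) (if i = 0 then X P.lm else 0)
      (if i = 0 then X P.lp else 0) := by
  cases i with
  | zero =>
    rw [seriesCoeff_zero]
    simpa using (flat_curve h hX hL).of_le (by omega)
  | succ i =>
    simpa using (flat_seriesCoeff_succ h hX hL i (by omega)).of_le (by omega)

theorem S_eq (X : ℝ → ℝ) (n : ℕ) (r t : ℝ) :
    P.S X n r t = X (P.Lam (r * t)) +
      ∑ i ∈ Finset.range n, P.seriesCoeff X (i + 1) (r * t) * r ^ (i + 1) := by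
  rw [S, Finset.sum_range_succ', seriesCoeff_zero]
  simp [add_comm]

theorem exists_bound_sum_pow {F : Filter ℝ} {n : ℕ} {a : ℕ → ℝ → ℝ} {m : ℕ}
    (ha : ∀ i < n, Tendsto (a i) F (𝓝 0)) (R : ℝ) {η : ℝ} (hη : 0 < η) :
    ∀ᶠ τ in F, ∀ r ∈ Ioc 0 R, |∑ i ∈ Finset.range n, a i τ * r ^ (i + m)| ≤ η := by
  have hlim : Tendsto (fun τ => ∑ i ∈ Finset.range n, |a i τ| * |R| ^ (i + m)) F (𝓝 0) := by
    have := tendsto_finsetSum (Finset.range n) fun i hi =>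
      ((ha i (Finset.mem_range.1 hi)).abs.mul_const (|R| ^ (i + m)))
    simpa using this
  filter_upwards [hlim.eventually (gt_mem_nhds hη)] with τ hτ r hr
  refine ((Finset.abs_sum_le_sum_abs _ _).trans ?_).trans hτ.le
  refine Finset.sum_le_sum fun i _ => ?_
  rw [abs_mul, abs_pow]
  gcongr
  exacts [hr.1.le, hr.2]

theorem continuous_S (h : P.Admissible) {X : ℝ → ℝ} (hX : P.IsEquilibriumCurve X) {n : ℕ}
    (hL : FlatAtEnds (n + 1) P.Lam P.lm P.lp) (t : ℝ) : Continuous fun r => P.S X n r t := by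
  unfold S
  refine continuous_finsetSum _ fun i hi => ?_
  have := (flat_seriesCoeff h hX hL i (by simpa [Nat.lt_succ_iff] using hi)).zero.1
  exact (this.comp (by fun_prop)).mul (by fun_prop)

/-- The corrections a_i with i ≥ 1 vanish at both ends. Fixing the slow time τ = r * t gives
uniformity in r ≤ R. -/
theorem S_near (h : P.Admissible) {X : ℝ → ℝ} (hX : P.IsEquilibriumCurve X) {n : ℕ}
    (hL : FlatAtEnds (n + 1) P.Lam P.lm P.lp) (R : ℝ) {η : ℝ} (hη : 0 < η) :
    (∀ᶠ τ in atBot, ∀ r ∈ Ioc 0 R, ∀ t, r * t = τ → |P.S X n r t - X P.lm| ≤ η) ∧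
    ∀ᶠ τ in atTop, ∀ r ∈ Ioc 0 R, ∀ t, r * t = τ → |P.S X n r t - X P.lp| ≤ η := by
  have h0 := (flat_curve h hX hL).zero
  have hs := fun i (hi : i < n) => (flat_seriesCoeff_succ h hX hL i (by omega)).zero
  have key : ∀ F : Filter ℝ, ∀ p, Tendsto (fun τ => X (P.Lam τ)) F (𝓝 p) →
      (∀ i < n, Tendsto (P.seriesCoeff X (i + 1)) F (𝓝 0)) →
      ∀ᶠ τ in F, ∀ r ∈ Ioc 0 R, ∀ t, r * t = τ → |P.S X n r t - p| ≤ η := by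
    intro F p hp ha
    filter_upwards [eventually_abs_sub_le hp (half_pos hη),
      exists_bound_sum_pow (m := 1) ha R (half_pos hη)] with τ h1 h2 r hr t ht
    rw [S_eq, ht, add_sub_right_comm]
    exact (abs_add_le _ _).trans (by linarith [h2 r hr])
  exact ⟨key _ _ h0.2.1 fun i hi => (hs i hi).2.1, key _ _ h0.2.2 fun i hi => (hs i hi).2.2⟩

theorem S_deriv (h : P.Admissible) {X : ℝ → ℝ} (hX : P.IsEquilibriumCurve X) {n : ℕ}
    (hL : FlatAtEnds (n + 1) P.Lam P.lm P.lp) (R : ℝ) :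
    ∃ S' : ℝ → ℝ → ℝ, (∀ r t, HasDerivAt (P.S X n r) (S' r t) t) ∧ ∀ η > 0,
      (∀ᶠ τ in atBot, ∀ r ∈ Ioc 0 R, ∀ t, r * t = τ → |S' r t| ≤ η) ∧
      ∀ᶠ τ in atTop, ∀ r ∈ Ioc 0 R, ∀ t, r * t = τ → |S' r t| ≤ η := by
  have hs := fun i (hi : i < n + 1) => flat_seriesCoeff h hX hL i (by omega)
  refine ⟨fun r t => ∑ i ∈ Finset.range (n + 1), deriv (P.seriesCoeff X i) (r * t) * r ^ (i + 1),
    fun r t => ?_, fun η hη => ⟨?_, ?_⟩⟩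
  · unfold S
    refine HasDerivAt.fun_sum fun i hi => ?_
    have h1 := ((hs i (Finset.mem_range.1 hi)).1.1 (r * t)).hasDerivAt
    have h2 := (h1.comp t ((hasDerivAt_id t).const_mul r)).mul_const (r ^ i)
    refine h2.congr_deriv ?_
    simp only [mul_one]
    ring
  · filter_upwards [exists_bound_sum_pow (m := 1) (fun i hi => (hs i hi).2.zero.2.1) R hη]
      with τ h2 r hr t ht
    rw [ht]; exact h2 r hr
  · filter_upwards [exists_bound_sum_pow (m := 1) (fun i hi => (hs i hi).2.zero.2.2) R hη]
      with τ h2 r hr t ht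
    rw [ht]; exact h2 r hr

/-- The corrections are bounded in time and each carries a factor r. -/
theorem S_slow (h : P.Admissible) {X : ℝ → ℝ} (hX : P.IsEquilibriumCurve X) {n : ℕ}
    (hL : FlatAtEnds (n + 1) P.Lam P.lm P.lp) {η : ℝ} (hη : 0 < η) :
    ∃ r1 > 0, ∀ r ∈ Ioo 0 r1, ∀ t, |P.S X n r t - X (P.Lam (r * t))| ≤ η := by
  have hs := fun i : ℕ => show ∃ C, 0 ≤ C ∧ (i < n → ∀ τ, |P.seriesCoeff X (i + 1) τ| ≤ C) by
    by_cases hi : i < n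
    · obtain ⟨C, hC, h1⟩ := (flat_seriesCoeff_succ h hX hL i (by omega)).exists_bound
      exact ⟨C, hC, fun _ => h1⟩
    · exact ⟨0, le_rfl, fun h => absurd h hi⟩
  choose C hC0 hC using hs
  have hlim : Tendsto (fun r : ℝ => ∑ i ∈ Finset.range n, C i * |r| ^ (i + 1)) (𝓝 0) (𝓝 0) := by
    have : Continuous fun r : ℝ => ∑ i ∈ Finset.range n, C i * |r| ^ (i + 1) := by fun_prop
    simpa using this.tendsto 0
  obtain ⟨r1, hr1, h1⟩ := Metric.eventually_nhds_iff.1 (hlim.eventually (gt_mem_nhds hη))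
  refine ⟨r1, hr1, fun r hr t => ?_⟩
  have h2 : ∑ i ∈ Finset.range n, C i * |r| ^ (i + 1) < η :=
    h1 (by rw [Real.dist_eq, sub_zero, abs_of_pos hr.1]; exact hr.2)
  rw [S_eq, add_sub_cancel_left]
  refine ((Finset.abs_sum_le_sum_abs _ _).trans (Finset.sum_le_sum fun i hi => ?_)).trans h2.le
  rw [abs_mul, abs_pow]
  gcongr
  exact hC i (Finset.mem_range.1 hi) _

theorem isGuide_S (h : P.Admissible) {n : ℕ} (hL : FlatAtEnds (n + 1) P.Lam P.lm P.lp) (R : ℝ) :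
    P.IsGuide R (P.S P.Xs n) where
  continuous := continuous_S h h.curve_Xs hL
  near := fun η hη => by
    obtain ⟨τ1, h1⟩ := eventually_atBot.1 (S_near h h.curve_Xs hL R hη).1
    exact ⟨τ1, fun r hr t ht => h1 _ ht r hr t rfl⟩
  deriv := by
    obtain ⟨S', h1, h2⟩ := S_deriv h h.curve_Xs hL R
    refine ⟨S', h1, fun η hη => ?_⟩
    obtain ⟨τ1, h3⟩ := eventually_atBot.1 (h2 η hη).1
    exact ⟨τ1, fun r hr t ht => h3 _ ht r hr t rfl⟩
  slow := fun η hη => S_slow h h.curve_Xs hL hη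
  curve := by
    have h1 := flat_curve h h.curve_Xs hL
    obtain ⟨C, -, hC⟩ := h1.2.exists_bound
    exact ⟨_, C, fun τ => ⟨(h1.1.1 τ).hasDerivAt, hC τ⟩⟩

theorem isGuide_rev_S (h : P.Admissible) {n : ℕ} (hL : FlatAtEnds (n + 1) P.Lam P.lm P.lp)
    (R : ℝ) : P.rev.IsGuide R fun r t => -P.S P.Xu n r (-t) where
  continuous := fun t => (continuous_S h h.curve_Xu hL (-t)).neg
  near := fun η hη => by
    obtain ⟨τ1, h1⟩ := eventually_atTop.1 (S_near h h.curve_Xu hL R hη).2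
    refine ⟨-τ1, fun r hr t ht => ?_⟩
    have := h1 (r * -t) (by linarith) r hr (-t) rfl
    rw [abs_sub_comm] at this
    simpa [rev, add_comm, sub_eq_add_neg] using this
  deriv := by
    obtain ⟨S', h1, h2⟩ := S_deriv h h.curve_Xu hL R
    refine ⟨fun r t => S' r (-t), fun r t => ?_, fun η hη => ?_⟩
    · refine (((h1 r (-t)).comp t (hasDerivAt_neg t)).neg).congr_deriv ?_
      simp
    · obtain ⟨τ1, h3⟩ := eventually_atTop.1 (h2 η hη).2
      exact ⟨-τ1, fun r hr t ht => h3 (r * -t) (by linarith) r hr (-t) rfl⟩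
  slow := fun η hη => by
    obtain ⟨r1, hr1, h1⟩ := S_slow h h.curve_Xu hL hη
    refine ⟨r1, hr1, fun r hr t => ?_⟩
    have := h1 r hr (-t)
    rw [abs_sub_comm] at this
    simpa [rev, add_comm, sub_eq_add_neg] using this
  curve := by
    have h1 := flat_curve h h.curve_Xu hL
    obtain ⟨C, -, hC⟩ := h1.2.exists_bound
    refine ⟨fun τ => _root_.deriv (fun τ => P.Xu (P.Lam τ)) (-τ), C, fun τ => ⟨?_, hC _⟩⟩
    have h2 := ((h1.1.1 (-τ)).hasDerivAt.comp τ (hasDerivAt_neg τ)).neg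
    simp only [mul_neg, mul_one, neg_neg] at h2
    refine h2.congr_of_eventuallyEq (Eventually.of_forall fun u => ?_)
    simp [rev]

namespace IsGuide

variable {R : ℝ} {σ : ℝ → ℝ → ℝ}

theorem continuous_sol (g : P.IsGuide R σ) (h : P.Admissible) (s c t : ℝ) :
    Continuous fun r => P.sol r s (σ r s + c) t := by
  refine continuous_iff_continuousAt.2 fun r0 => ?_
  refine continuousAt_solution h (x := fun r => P.sol r s (σ r s + c)) (s := s) t
    (Eventually.of_forall fun r => isSolution_sol h r s _) ?_
  simp only [sol_self h]
  exact ((g.continuous s).add continuous_const).continuousAt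

/-- In the far past the guide and `xMinus` share a limit, so the shift c keeps the starting value
inside the radius δ. -/
theorem tendsto_sol (g : P.IsGuide R σ) (h : P.Admissible) {r : ℝ} (hr : r ∈ Ioc 0 R) {δ c : ℝ}
    (hc : |c| < δ) (hp : P.IsPullbackAttractingOn r (P.xMinus r) 0 δ) :
    Tendsto (fun τ => P.sol r (-τ) (σ r (-τ) + c) 0) atTop (𝓝 (P.xMinus r 0)) := by
  classical
  set e := (δ - |c|) / 3 with he
  have he0 : 0 < e := by linarith
  obtain ⟨τ1, h1⟩ := g.near e he0
  have hev : ∀ᶠ s in atBot, |σ r s + c - P.xMinus r s| < δ := by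
    filter_upwards [eventually_le_atBot_div hr.1 τ1,
      eventually_abs_sub_le (tendsto_xMinus h hr.1) he0] with s hs1 hs2
    have h2 := h1 r hr s hs1
    have h3 := abs_add_three (σ r s - P.Xs P.lm) c (-(P.xMinus r s - P.Xs P.lm))
    rw [abs_neg] at h3
    rw [show σ r s + c - P.xMinus r s =
      σ r s - P.Xs P.lm + c + -(P.xMinus r s - P.Xs P.lm) by ring]
    linarith
  have hδ : 0 < δ := (abs_nonneg c).trans_lt hc
  -- Pullback attraction asks for admissible starting values at all s ≤ 0. They are replaced by
  -- `xMinus` where the guide is too far away, which does not affect the limit s → -∞.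
  have := hp (fun s => if |σ r s + c - P.xMinus r s| < δ then σ r s + c else P.xMinus r s)
    (fun s _ => by
      split_ifs with hs
      · exact hs
      · simpa using hδ) 0 le_rfl
  have h2 : Tendsto (fun s => |P.xMinus r 0 - P.sol r s (σ r s + c) 0|) atBot (𝓝 0) := by
    refine this.congr' ?_
    filter_upwards [hev] with s hs
    rw [if_pos hs]
  have h3 := h2.comp tendsto_neg_atTop_atBot
  rw [tendsto_iff_dist_tendsto_zero]
  refine h3.congr fun τ => ?_
  rw [dist_comm, Real.dist_eq]
  rfl

/-- Turns a threshold in slow time into one in τ valid for all rates r ≥ r1; this is why the uniform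
statements stay away from r = 0. -/
theorem mul_neg_le {r r1 τ τ1 : ℝ} (hr1 : 0 < r1) (hr : r1 ≤ r) (hτ : |τ1| / r1 ≤ τ) :
    r * -τ ≤ τ1 := by
  rw [div_le_iff₀ hr1] at hτ
  have h1 := abs_nonneg τ1
  have h2 : 0 ≤ τ := by
    by_contra! hc
    nlinarith
  have := neg_abs_le τ1
  nlinarith

/-- At early times σ and `xMinus` are both within ε/3 of `Xs lm`, so the shift by ±ε decides the
order, which the flow preserves. -/
theorem sol_lt (g : P.IsGuide R σ) (h : P.Admissible) {ε : ℝ} (hε : 0 < ε) {r1 : ℝ}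
    (hr1 : 0 < r1) : ∃ τ0 ≥ 0, ∀ r ∈ Icc r1 R, ∀ τ ≥ τ0,
      P.sol r (-τ) (σ r (-τ) + -ε) 0 < P.xMinus r 0 ∧
      P.xMinus r 0 < P.sol r (-τ) (σ r (-τ) + ε) 0 := by
  obtain ⟨τ1, h1⟩ := g.near (ε / 3) (by linarith)
  obtain ⟨τ2, h2⟩ := xMinus_near h (η := ε / 3) (by linarith)
  refine ⟨|min τ1 τ2| / r1, by positivity, fun r hr τ hτ => ?_⟩
  have hr0 : 0 < r := hr1.trans_le hr.1
  have hle := mul_neg_le hr1 hr.1 hτ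
  have h3 := abs_le.1 (h1 r ⟨hr0, hr.2⟩ (-τ) (hle.trans (min_le_left _ _)))
  have h4 := abs_le.1 (h2 r hr0 (-τ) (hle.trans (min_le_right _ _)))
  constructor
  · refine (isSolution_sol h _ _ _).lt h (isSolution_xMinus h hr0) (s := -τ) ?_ 0
    rw [sol_self h]
    linarith
  · refine (isSolution_xMinus h hr0).lt h (isSolution_sol h _ _ _) (s := -τ) ?_ 0
    rw [sol_self h]
    linarith

/-- In the far past σ - ε is a strict subsolution: it is nearly flat, while f is bounded below by a
positive constant near `Xs lm` - ε, a point of the gap. A solution started on it earlier is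
therefore above it at later starting times. -/
theorem sol_mono (g : P.IsGuide R σ) (h : P.Admissible) {ε : ℝ} (hε : 0 < ε)
    (hε' : ε < P.Xs P.lm - P.Xu P.lm) {r1 : ℝ} (hr1 : 0 < r1) :
    ∃ τ0 ≥ 0, ∀ r ∈ Icc r1 R, ∀ τ ≥ τ0, ∀ τ' ≥ τ,
      P.sol r (-τ) (σ r (-τ) + -ε) 0 ≤ P.sol r (-τ') (σ r (-τ') + -ε) 0 := by
  have hpos : 0 < P.f (P.Xs P.lm + -ε) P.lm :=
    h.pos_between _ h.lm_mem _ ⟨by linarith, by linarith⟩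
  set κ := P.f (P.Xs P.lm + -ε) P.lm / 2 with hκ
  have hev : ∀ᶠ p in 𝓝 (P.Xs P.lm + -ε, P.lm), κ < P.f p.1 p.2 :=
    h.continuous_f.tendsto (P.Xs P.lm + -ε, P.lm) |>.eventually
      (lt_mem_nhds (show κ < P.f (P.Xs P.lm + -ε) P.lm by linarith))
  rw [nhds_prod_eq] at hev
  obtain ⟨p1, hp1, p2, hp2, h3⟩ := eventually_prod_iff.1 hev
  obtain ⟨η, hη, h4⟩ := Metric.nhds_basis_closedBall.eventually_iff.1 hp1
  obtain ⟨τ1, h1⟩ := g.near η hη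
  obtain ⟨σ', hσ', hd⟩ := g.deriv
  obtain ⟨τ2, h2⟩ := hd κ (by linarith)
  obtain ⟨τ3, h5⟩ := eventually_atBot.1 (h.tendsto_Lam_atBot.eventually hp2)
  refine ⟨|min (min τ1 τ2) τ3| / r1, by positivity, fun r hr τ hτ τ' hτ' => ?_⟩
  have hr0 : 0 < r := hr1.trans_le hr.1
  have hsol := isSolution_sol h r (-τ') (σ r (-τ') + -ε)
  refine (isSolution_sol h r (-τ) _).le h hsol (s := -τ) ?_ 0
  rw [sol_self h]
  refine hsol.ge_of_lower (b := fun t => σ r t + -ε) (b' := σ' r) (s := -τ')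
    (fun u _ => (hσ' r u).add_const _) (fun u hu => ?_) (by rw [sol_self h])
    (neg_le_neg hτ')
  have hu' : r * u ≤ min (min τ1 τ2) τ3 := by
    have := mul_neg_le hr1 hr.1 (hτ.trans (by linarith [hu.2] : τ ≤ -u))
    rwa [neg_neg] at this
  have e1 := h1 r ⟨hr0, hr.2⟩ u (hu'.trans ((min_le_left _ _).trans (min_le_left _ _)))
  have e2 := h2 r ⟨hr0, hr.2⟩ u (hu'.trans ((min_le_left _ _).trans (min_le_right _ _)))
  have e3 := h5 (r * u) (hu'.trans (min_le_right _ _))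
  refine (le_of_abs_le e2).trans_lt (h3 (h4 ?_) e3)
  rw [Metric.mem_closedBall, Real.dist_eq, add_sub_add_right_eq_sub]
  exact e1

/-- The curve Xs(Λ(rt)) - ρ moves at speed O(r), while f along it is at least κ > 0 by compactness,
so it is a subsolution for small r. The margin ρ - ε absorbs the distance from σ to Xs(Λ(rt)). -/
theorem le_sol_of_slow (g : P.IsGuide R σ) (h : P.Admissible) {ε ρ : ℝ} (hρ0 : 0 < ρ)
    (hρ : ε < ρ)
    (hgap : ∀ l ∈ Icc P.lm P.lp, ρ < P.Xs l - P.Xu l) : ∃ r1 > 0, ∀ r ∈ Ioo 0 r1, ∀ τ ≥ 0,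
      P.Xs (P.Lam 0) - ρ ≤ P.sol r (-τ) (σ r (-τ) + -ε) 0 := by
  have hcont : ContinuousOn (fun l => P.f (P.Xs l - ρ) l) (Icc P.lm P.lp) :=
    h.continuous_f.comp_continuousOn ((h.curve_Xs.1.sub continuousOn_const).prodMk continuousOn_id)
  obtain ⟨l0, hl0, hmin⟩ := isCompact_Icc.exists_isMinOn ⟨P.lm, h.lm_mem⟩ hcont
  set κ := P.f (P.Xs l0 - ρ) l0 with hκ
  have hκ0 : 0 < κ := h.pos_between l0 hl0 _ ⟨by linarith [hgap l0 hl0], by linarith⟩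
  obtain ⟨r2, hr2, h2⟩ := g.slow (ρ - ε) (by linarith)
  obtain ⟨D, C, hD⟩ := g.curve
  have hC : 0 ≤ C := (abs_nonneg _).trans (hD 0).2
  refine ⟨min r2 (κ / (C + 1)), lt_min hr2 (by positivity), fun r hr τ hτ => ?_⟩
  have hsol := isSolution_sol h r (-τ) (σ r (-τ) + -ε)
  have key := hsol.ge_of_lower (b := fun t => P.Xs (P.Lam (r * t)) - ρ)
    (b' := fun t => D (r * t) * r) (s := -τ) (t := 0) (fun u _ => ?_) (fun u _ => ?_) ?_
    (by linarith)
  · simpa using key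
  · have := (hD (r * u)).1.comp u ((hasDerivAt_id u).const_mul r)
    simpa using! this.sub_const ρ
  · have h3 : κ ≤ P.f (P.Xs (P.Lam (r * u)) - ρ) (P.Lam (r * u)) := hmin (h.Lam_mem _)
    refine lt_of_lt_of_le ?_ h3
    have h4 : r * (C + 1) < κ := by
      rw [← lt_div_iff₀ (by positivity)]
      exact hr.2.trans_le (min_le_right _ _)
    have h5 : D (r * u) * r ≤ C * r :=
      mul_le_mul_of_nonneg_right (le_of_abs_le (hD _).2) hr.1.le
    nlinarith [hr.1]
  · rw [sol_self h]
    have := abs_le.1 (h2 r ⟨hr.1, hr.2.trans_le (min_le_left _ _)⟩ (-τ))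
    linarith

end IsGuide

/-! ### Forward convergence to the stable equilibrium -/

theorem exists_forall_ge_of_pos {G : ℝ → ℝ → ℝ} (hG : Continuous (Function.uncurry G)) {K : Set ℝ}
    (hK : IsCompact K) {l0 : ℝ} (hpos : ∀ x ∈ K, 0 < G x l0) :
    ∃ κ > 0, ∀ᶠ l in 𝓝 l0, ∀ x ∈ K, κ ≤ G x l := by
  rcases K.eq_empty_or_nonempty with rfl | hne
  · exact ⟨1, one_pos, by simp⟩
  obtain ⟨x0, hx0, hmin⟩ := hK.exists_isMinOn hne
    (hG.comp (f := fun x => (x, l0)) (by fun_prop)).continuousOn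
  have hp := hpos x0 hx0
  refine ⟨G x0 l0 / 2, by linarith, ?_⟩
  refine hK.eventually_forall_of_forall_eventually fun x hx => ?_
  have hc : Continuous fun p : ℝ × ℝ => G p.2 p.1 :=
    hG.comp (continuous_snd.prodMk continuous_fst)
  have h1 : G x0 l0 ≤ G x l0 := hmin hx
  exact (hc.tendsto (l0, x) |>.eventually
    (lt_mem_nhds (show G x0 l0 / 2 < G x l0 by linarith))).mono fun _ h => le_of_lt h

theorem exists_ge_of_deriv_ge {x v : ℝ → ℝ} (hx : ∀ t, HasDerivAt x (v t) t) {c d κ T : ℝ}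
    (hκ : 0 < κ) (hc : ∀ t ≥ T, c ≤ x t) (hv : ∀ t ≥ T, x t ∈ Icc c d → κ ≤ v t) :
    ∃ t ≥ T, d ≤ x t := by
  by_contra! hcon
  have hle : ∀ t ≥ T, κ * (t - T) ≤ x t - x T := fun t ht =>
    (convex_Ici T).mul_sub_le_image_sub_of_le_deriv
      (fun u _ => (hx u).continuousAt.continuousWithinAt)
      (fun u _ => (hx u).differentiableAt.differentiableWithinAt)
      (fun u hu => by
        have hu' : T ≤ u := interior_subset hu
        rw [(hx u).deriv]
        exact hv u hu' ⟨hc u hu', (hcon u hu').le⟩) T self_mem_Ici t ht ht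
  have h1 : T ≤ T + (d - c) / κ := by
    have : c ≤ d := (hc T le_rfl).trans (hcon T le_rfl).le
    have := div_nonneg (sub_nonneg.2 this) hκ.le
    linarith
  have h2 := hle _ h1
  have h3 : κ * (T + (d - c) / κ - T) = d - c := by field_simp; ring
  linarith [hcon _ h1, hc T le_rfl]

/-- The level `Xs lp` + η0 is an upper barrier at late times. By uniqueness of `xPlus` the solution
cannot stay near `Xu lp`, so it rises above a level c in the gap at a late time, and c is then a
lower barrier. Between the barriers the sign of f drives it into every tube around `Xs lp`. The
constants η0 and τ2 do not depend on r. -/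
theorem tendsto_of_gt_xPlus (h : P.Admissible) : ∃ η0 > 0, ∃ τ2, ∀ r > 0, ∀ x : ℝ → ℝ,
    P.IsSolution r x → (∀ t, P.xPlus r t < x t) →
    (∃ T, τ2 ≤ r * T ∧ x T ≤ P.Xs P.lp + η0) → Tendsto x atTop (𝓝 (P.Xs P.lp)) := by
  obtain ⟨α, hα, η0, hη0, -, hneg, hposd, hs⟩ := h.exists_inward h.lp_mem
  obtain ⟨η1, hη1, huniq⟩ := eq_xPlus_of_eventually h
  obtain ⟨τ2, hτ2⟩ := eventually_atTop.1 (h.tendsto_Lam_atTop.eventually (hs η0 ⟨hη0, le_rfl⟩))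
  have hpq := h.Xu_lt_Xs _ h.lp_mem
  set p := P.Xu P.lp
  set q := P.Xs P.lp
  refine ⟨η0, hη0, τ2, fun r hr x hx hgt ⟨T, hT, hxT⟩ => ?_⟩
  have hrt : ∀ s t, s ≤ t → r * s ≤ r * t := fun s t hst => mul_le_mul_of_nonneg_left hst hr.le
  have hup : ∀ t ≥ T, x t ≤ q + η0 := fun t ht =>
    hx.le_const (fun u hu => (hτ2 _ (hT.trans (hrt _ _ hu.1))).1) hxT ht
  -- Staying below c would be within the uniqueness radius η1 of p; the midpoint bound keeps c below
  -- q.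
  set c := p + min η1 ((q - p) / 2) with hc
  have hcp : p < c := by
    have : 0 < min η1 ((q - p) / 2) := lt_min hη1 (by linarith)
    linarith
  have hcq : c < q := by
    have : min η1 ((q - p) / 2) ≤ (q - p) / 2 := min_le_right _ _
    linarith
  have hfreq : ∃ᶠ t in atTop, c < x t := by
    intro hcon
    have hx1 : x = P.xPlus r := by
      refine huniq r hr x hx ?_
      filter_upwards [hcon, eventually_abs_sub_le (tendsto_xPlus h hr) hη1] with t h1 h2
      rw [abs_le] at h2 ⊢
      have h3 : min η1 ((q - p) / 2) ≤ η1 := min_le_left _ _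
      constructor <;> linarith [hgt t, not_lt.1 h1, h2.1]
    have := hgt 0
    rw [hx1] at this
    exact lt_irrefl _ this
  rw [(nhds_basis_Icc_pos q).tendsto_right_iff]
  intro e he
  set η := min e η0 with hη
  have hηpos : 0 < η := lt_min he hη0
  have hηle : η ≤ η0 := min_le_right _ _
  have hηe : η ≤ e := min_le_left _ _
  obtain ⟨κ1, hκ1, hK1⟩ := exists_forall_ge_of_pos h.continuous_f (isCompact_Icc (a := c)
    (b := q - η)) (l0 := P.lp) fun y hy =>
      h.pos_between _ h.lp_mem y ⟨hcp.trans_le hy.1, by linarith [hy.2]⟩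
  obtain ⟨κ2, hκ2, hK2⟩ := exists_forall_ge_of_pos (G := fun y l => -P.f y l) h.continuous_f.neg
    (isCompact_Icc (a := q + η) (b := q + η0)) (l0 := P.lp) fun y hy =>
      neg_pos.2 (hneg y ⟨by linarith [hy.1], hy.2⟩)
  have hcpos : ∀ᶠ l in 𝓝 P.lp, 0 < P.f c l := (h.continuous_f_right c).tendsto P.lp |>.eventually
    (lt_mem_nhds (h.pos_between _ h.lp_mem c ⟨hcp, hcq⟩))
  obtain ⟨τ3, hτ3⟩ := eventually_atTop.1 (h.tendsto_Lam_atTop.eventually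
    (hK1.and (hK2.and (hcpos.and (hs η ⟨hηpos, hηle⟩)))))
  have hev : ∀ᶠ t in atTop, τ3 ≤ r * t :=
    (tendsto_id.const_mul_atTop hr).eventually (eventually_ge_atTop τ3)
  obtain ⟨T1, hT1, hT1', hT1T⟩ := (hfreq.and_eventually (hev.and (eventually_ge_atTop T))).exists
  have hτ : ∀ t ≥ T1, τ3 ≤ r * t := fun t ht => hT1'.trans (hrt _ _ ht)
  have hcx : ∀ t ≥ T1, c ≤ x t := fun t ht =>
    hx.ge_const (fun u hu => (hτ3 _ (hτ u hu.1)).2.2.1) hT1.le ht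
  obtain ⟨t1, ht1, hd1⟩ := exists_ge_of_deriv_ge hx (d := q - η) hκ1 hcx
    fun t ht hxt => (hτ3 _ (hτ t ht)).1 _ hxt
  obtain ⟨t2, ht2, hd2⟩ := exists_ge_of_deriv_ge (x := fun t => -x t) (fun t => (hx t).neg)
    (c := -(q + η0)) (d := -(q + η)) (T := T1) hκ2
    (fun t ht => neg_le_neg (hup t (hT1T.trans ht)))
    fun t ht hxt => (hτ3 _ (hτ t ht)).2.1 _ ⟨by linarith [hxt.2], by linarith [hxt.1]⟩
  filter_upwards [eventually_ge_atTop t1, eventually_ge_atTop t2] with t h1 h2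
  constructor
  · have := hx.ge_const (fun u hu => (hτ3 _ (hτ u (ht1.trans hu.1))).2.2.2.2) hd1 h1
    linarith
  · have := hx.le_const (fun u hu => (hτ3 _ (hτ u (ht2.trans hu.1))).2.2.2.1)
      (by linarith : x t2 ≤ q + η) h2
    linarith

/-! ### The functions Din and Dout -/

theorem IsPullbackRepellingOn.rev (h : P.Admissible) {r δ : ℝ} (hr : 0 < r)
    (hp : P.IsPullbackRepellingOn r (P.xPlus r) 0 δ) :
    P.rev.IsPullbackAttractingOn r (P.rev.xMinus r) 0 δ := by
  intro ξ hξ t ht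
  have h1 := hp (fun s => -ξ (-s)) (fun s hs => by
    have := hξ (-s) (by linarith)
    rw [rev_xMinus h hr, neg_neg, abs_sub_comm] at this
    rwa [show -ξ (-s) - P.xPlus r s = -P.xPlus r s - ξ (-s) by ring]) (-t) (by linarith)
  refine (h1.comp tendsto_neg_atBot_atTop).congr fun s => ?_
  simp only [Function.comp_apply, neg_neg]
  rw [rev_xMinus h hr, rev_sol h, abs_sub_comm]
  congr 1
  ring

theorem xPlus_zero (h : P.Admissible) {r : ℝ} (hr : 0 < r) :
    P.xPlus r 0 = -P.rev.xMinus r 0 := by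
  simp [rev_xMinus h hr]

/-- The subtracted solution is the negative of one of the reversed problem, so both terms are
evolutions started on a guide at time -τ and the estimates for guides simply add. -/
theorem Dout_eq (h : P.Admissible) (n : ℕ) (ε τ r : ℝ) :
    P.Dout n ε τ r = P.sol r (-τ) (P.S P.Xs n r (-τ) + ε) 0 +
      P.rev.sol r (-τ) ((fun r t => -P.S P.Xu n r (-t)) r (-τ) + ε) 0 := by
  simp [Dout, yMinus, yPlus, rev_sol h, sub_eq_add_neg, add_comm]

theorem Din_eq (h : P.Admissible) (n : ℕ) (ε τ r : ℝ) :
    P.Din n ε τ r = P.sol r (-τ) (P.S P.Xs n r (-τ) + -ε) 0 +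
      P.rev.sol r (-τ) ((fun r t => -P.S P.Xu n r (-t)) r (-τ) + -ε) 0 := by
  simp [Din, zMinus, zPlus, rev_sol h, sub_eq_add_neg, add_comm]

theorem Din_lt_Dout (h : P.Admissible) (n : ℕ) {ε : ℝ} (hε : 0 < ε) (τ r : ℝ) :
    P.Din n ε τ r < P.Dout n ε τ r := by
  rw [Din_eq h, Dout_eq h]
  refine add_lt_add ?_ ?_
  · refine (isSolution_sol h _ _ _).lt h (isSolution_sol h _ _ _) (s := -τ) ?_ 0
    rw [sol_self h, sol_self h]
    linarith
  · refine (isSolution_sol h.rev _ _ _).lt h.rev (isSolution_sol h.rev _ _ _) (s := -τ) ?_ 0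
    rw [sol_self h.rev, sol_self h.rev]
    linarith

section Flat

variable {n : ℕ} (h : P.Admissible) (hL : FlatAtEnds (n + 1) P.Lam P.lm P.lp)
include h hL

theorem continuous_Din (ε τ : ℝ) : Continuous fun r => P.Din n ε τ r := by
  simp only [Din_eq h]
  exact ((isGuide_S h hL 1).continuous_sol h _ _ _).add
    ((isGuide_rev_S h hL 1).continuous_sol h.rev _ _ _)

theorem tendsto_D {r δ δ' ε : ℝ} (hr : 0 < r) (hε : 0 < ε) (hδ : ε < δ) (hδ' : ε < δ')
    (hattr : P.IsPullbackAttractingOn r (P.xMinus r) 0 δ)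
    (hrep : P.IsPullbackRepellingOn r (P.xPlus r) 0 δ') :
    Tendsto (fun τ => P.Din n ε τ r) atTop (𝓝 (P.xMinus r 0 - P.xPlus r 0)) ∧
    Tendsto (fun τ => P.Dout n ε τ r) atTop (𝓝 (P.xMinus r 0 - P.xPlus r 0)) := by
  simp only [Din_eq h, Dout_eq h]
  rw [xPlus_zero h hr, sub_neg_eq_add]
  have hrR : r ∈ Ioc 0 r := ⟨hr, le_rfl⟩
  have habs : |ε| = ε := abs_of_pos hε
  exact ⟨((isGuide_S h hL r).tendsto_sol h hrR (by rwa [abs_neg, habs]) hattr).add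
      ((isGuide_rev_S h hL r).tendsto_sol h.rev hrR (by rwa [abs_neg, habs]) (hrep.rev h hr)),
    ((isGuide_S h hL r).tendsto_sol h hrR (by rwa [habs]) hattr).add
      ((isGuide_rev_S h hL r).tendsto_sol h.rev hrR (by rwa [habs]) (hrep.rev h hr))⟩

theorem Din_lt_sub_lt_Dout (R : ℝ) {ε : ℝ} (hε : 0 < ε) {r1 : ℝ} (hr1 : 0 < r1) :
    ∃ τ0 ≥ 0, ∀ r ∈ Icc r1 R, ∀ τ ≥ τ0, P.Din n ε τ r < P.xMinus r 0 - P.xPlus r 0 ∧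
      P.xMinus r 0 - P.xPlus r 0 < P.Dout n ε τ r := by
  obtain ⟨τ1, hτ1, h1⟩ := (isGuide_S h hL R).sol_lt h hε hr1
  obtain ⟨τ2, hτ2, h2⟩ := (isGuide_rev_S h hL R).sol_lt h.rev hε hr1
  refine ⟨max τ1 τ2, le_max_of_le_left hτ1, fun r hr τ hτ => ?_⟩
  have e1 := h1 r hr τ ((le_max_left _ _).trans hτ)
  have e2 := h2 r hr τ ((le_max_right _ _).trans hτ)
  rw [Din_eq h, Dout_eq h, xPlus_zero h (hr1.trans_le hr.1), sub_neg_eq_add]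
  exact ⟨add_lt_add e1.1 e2.1, add_lt_add e1.2 e2.2⟩

theorem Din_mono (R : ℝ) {ε : ℝ} (hε : 0 < ε)
    (hgap : ∀ l ∈ Icc P.lm P.lp, ε < P.Xs l - P.Xu l) {r1 : ℝ} (hr1 : 0 < r1) :
    ∃ τ0 ≥ 0, ∀ r ∈ Icc r1 R, ∀ τ ≥ τ0, ∀ τ' ≥ τ, P.Din n ε τ r ≤ P.Din n ε τ' r := by
  obtain ⟨τ1, hτ1, h1⟩ := (isGuide_S h hL R).sol_mono h hε (hgap _ h.lm_mem) hr1
  obtain ⟨τ2, hτ2, h2⟩ := (isGuide_rev_S h hL R).sol_mono h.rev hε (by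
    have := hgap _ h.lp_mem
    simp only [rev, neg_neg]
    linarith) hr1
  refine ⟨max τ1 τ2, le_max_of_le_left hτ1, fun r hr τ hτ τ' hτ' => ?_⟩
  rw [Din_eq h, Din_eq h]
  exact add_le_add (h1 r hr τ ((le_max_left _ _).trans hτ) τ' hτ')
    (h2 r hr τ ((le_max_right _ _).trans hτ) τ' hτ')

/-- With ε < ρ < d0 / 2, slow drift keeps the two solutions within ρ of the curves on the side of
the gap, which are more than d0 apart; d0 - 2ρ remains. -/
theorem exists_le_Din {ε d0 : ℝ} (hε : ε ∈ Ioo 0 (d0 / 2))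
    (hgap : ∀ l ∈ Icc P.lm P.lp, d0 < P.Xs l - P.Xu l) :
    ∃ κ > 0, ∃ r1 > 0, ∀ r ∈ Ioo 0 r1, ∀ τ ≥ 0, κ ≤ P.Din n ε τ r := by
  obtain ⟨ρ, hρ1, hρ2⟩ := exists_between hε.2
  have hρ0 : 0 < ρ := hε.1.trans hρ1
  obtain ⟨r1, hr1, h1⟩ := (isGuide_S h hL 1).le_sol_of_slow h hρ0 hρ1
    fun l hl => by linarith [hgap l hl]
  obtain ⟨r2, hr2, h2⟩ := (isGuide_rev_S h hL 1).le_sol_of_slow h.rev hρ0 hρ1 fun l hl => by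
    have := hgap _ (mem_Icc_rev hl)
    simp only [rev]
    linarith
  refine ⟨d0 - 2 * ρ, by linarith, min r1 r2, lt_min hr1 hr2, fun r hr τ hτ => ?_⟩
  have e1 := h1 r ⟨hr.1, hr.2.trans_le (min_le_left _ _)⟩ τ hτ
  have e2 := h2 r ⟨hr.1, hr.2.trans_le (min_le_right _ _)⟩ τ hτ
  have e3 := hgap _ (h.Lam_mem 0)
  have e4 : P.rev.Xs (P.rev.Lam 0) = -P.Xu (P.Lam 0) := by simp [rev]
  rw [Din_eq h]
  linarith

end Flat

/-! ### End-point tracking and collisions -/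

theorem EndPointTracks.lt (h : P.Admissible) {r : ℝ} (hr : 0 < r) (ht : P.EndPointTracks r) :
    P.xPlus r 0 < P.xMinus r 0 := by
  by_contra! hcon
  have h1 := (isSolution_xMinus h hr).le h (isSolution_xPlus h hr) hcon
  exact absurd (le_of_tendsto_of_tendsto' ht (tendsto_xPlus h hr) h1)
    (h.Xu_lt_Xs _ h.lp_mem).not_ge

/-- At the collision rate `xMinus` tends to `Xu lp`, so at some late T it lies below `Xs lp` + η0.
Continuity in r transfers this to nearby rates, where `tendsto_of_gt_xPlus` applies. -/
theorem exists_endPointTracks (h : P.Admissible) {rs : ℝ} (hrs : 0 < rs)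
    (heq : P.xMinus rs = P.xPlus rs) :
    ∃ η > 0, ∀ r ∈ Ioo (rs - η) (rs + η), P.xPlus r 0 < P.xMinus r 0 → P.EndPointTracks r := by
  obtain ⟨η0, hη0, τ2, ht⟩ := tendsto_of_gt_xPlus h
  have hlt : P.Xu P.lp < P.Xs P.lp + η0 := by linarith [h.Xu_lt_Xs _ h.lp_mem]
  -- T is late enough already for the rate rs / 2, hence for every larger rate, since T ≥ 0.
  obtain ⟨T, hT1, hT2⟩ := ((tendsto_xPlus h hrs).eventually (gt_mem_nhds hlt)).and
    ((tendsto_id.const_mul_atTop (half_pos hrs)).eventually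
      (eventually_ge_atTop (max τ2 0))) |>.exists
  simp only [id] at hT2
  have hT0 : 0 ≤ T := by
    by_contra! hc
    nlinarith [le_max_right τ2 0]
  rw [← heq] at hT1
  have hev := ((continuousAt_xMinus h hrs T).eventually (gt_mem_nhds hT1)).and
    (eventually_gt_nhds (show rs / 2 < rs by linarith))
  obtain ⟨η, hη, hball⟩ := Metric.eventually_nhds_iff_ball.1 hev
  refine ⟨η, hη, fun r hr hgt => ?_⟩
  rw [← Real.ball_eq_Ioo] at hr
  obtain ⟨h1, h2⟩ := hball r hr
  have hr0 : 0 < r := by linarith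
  refine ht r hr0 _ (isSolution_xMinus h hr0)
    ((isSolution_xPlus h hr0).lt h (isSolution_xMinus h hr0) hgt) ⟨T, ?_, h1.le⟩
  have : rs / 2 * T ≤ r * T := mul_le_mul_of_nonneg_right h2.le hT0
  exact (le_max_left _ _).trans (hT2.trans this)

theorem xMinus_eq_xPlus (h : P.Admissible) {r : ℝ} (hr : 0 < r)
    (h0 : P.xMinus r 0 = P.xPlus r 0) : P.xMinus r = P.xPlus r :=
  (isSolution_xMinus h hr).eq h (isSolution_xPlus h hr) h0

theorem xPlus_le_of_left (h : P.Admissible) {rs η : ℝ} (hrs : 0 < rs) (hη : 0 < η)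
    (hle : ∀ r ∈ Ioo (rs - η) rs, P.xPlus r 0 ≤ P.xMinus r 0) :
    P.xPlus rs 0 ≤ P.xMinus rs 0 := by
  refine le_of_tendsto_of_tendsto (b := 𝓝[<] rs)
    ((continuousAt_xPlus h hrs 0).tendsto.mono_left nhdsWithin_le_nhds)
    ((continuousAt_xMinus h hrs 0).tendsto.mono_left nhdsWithin_le_nhds) ?_
  filter_upwards [Ioo_mem_nhdsLT (show rs - η < rs by linarith)] with r hr using hle r hr

theorem xMinus_le_of_right (h : P.Admissible) {rs η : ℝ} (hrs : 0 < rs) (hη : 0 < η)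
    (hle : ∀ r ∈ Ioo rs (rs + η), P.xMinus r 0 ≤ P.xPlus r 0) :
    P.xMinus rs 0 ≤ P.xPlus rs 0 := by
  refine le_of_tendsto_of_tendsto (b := 𝓝[>] rs)
    ((continuousAt_xMinus h hrs 0).tendsto.mono_left nhdsWithin_le_nhds)
    ((continuousAt_xPlus h hrs 0).tendsto.mono_left nhdsWithin_le_nhds) ?_
  filter_upwards [Ioo_mem_nhdsGT (show rs < rs + η by linarith)] with r hr using hle r hr

/-- Among the `d ≤ rs` such that a property holds on `(rs - d, rs]`, if any, there is a largest
one. -/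
theorem isGreatest_csSup_Ioc {p : ℝ → Prop} {rs : ℝ}
    (hne : {d : ℝ | d ∈ Ioc 0 rs ∧ ∀ r ∈ Ioc (rs - d) rs, p r}.Nonempty) :
    IsGreatest {d : ℝ | d ∈ Ioc 0 rs ∧ ∀ r ∈ Ioc (rs - d) rs, p r}
      (sSup {d : ℝ | d ∈ Ioc 0 rs ∧ ∀ r ∈ Ioc (rs - d) rs, p r}) := by
  have hbdd : BddAbove {d : ℝ | d ∈ Ioc 0 rs ∧ ∀ r ∈ Ioc (rs - d) rs, p r} :=
    ⟨rs, fun d hd => hd.1.2⟩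
  obtain ⟨d, hd⟩ := hne
  refine ⟨⟨⟨hd.1.1.trans_le (le_csSup hbdd hd), csSup_le ⟨d, hd⟩ fun d hd => hd.1.2⟩,
    fun r hr => ?_⟩, fun d hd => le_csSup hbdd hd⟩
  obtain ⟨e, he, hlt⟩ := exists_lt_of_lt_csSup ⟨d, hd⟩ (show rs - r < _ by linarith [hr.1])
  exact he.2 r ⟨by linarith, hr.2⟩

end RateProblem

/-! ### The main theorem -/

theorem mainTheorem2 (P : RateProblem) (d0 : ℝ) (h0 : P.H0) (h1 : P.H1 d0)
    (hf : ContDiff ℝ ∞ (Function.uncurry P.f))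
    (n : ℕ) (hLam : ContDiff ℝ (n + 1 : ℕ) P.Lam)
    (hLam_bot : ∀ k ∈ Finset.Icc 1 (n + 1), Tendsto (iteratedDeriv k P.Lam) atBot (𝓝 0))
    (hLam_top : ∀ k ∈ Finset.Icc 1 (n + 1), Tendsto (iteratedDeriv k P.Lam) atTop (𝓝 0))
    (rt : ℝ) (hrt : 0 < rt) (ε : ℝ) (hε : ε ∈ Ioo 0 (d0 / 2))
    (hattr : ∀ r ∈ Ioc 0 rt, ∃ δ > ε, P.IsPullbackAttractingOn r (P.xMinus r) 0 δ)
    (hrep : ∀ r ∈ Ioc 0 rt, ∃ δ > ε, P.IsPullbackRepellingOn r (P.xPlus r) 0 δ) :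
    ∃ rbar ∈ Ioo 0 rt,
      -- positivity for slow drifts
      (∀ r ∈ Ioo 0 rbar, ∀ τ ≥ 0, 0 < P.Dout n ε τ r ∧ 0 < P.Din n ε τ r) ∧
      ∀ rs ∈ Ioo 0 rt,
        -- (a) if and only if (b), with the same critical rate
        (P.CollideInTipping rs ↔
          rbar < rs ∧ ∃ τin ≥ 0, ∃ δ : ℝ → ℝ,
            (∀ τ > τin, IsGreatest
              {d : ℝ | d ∈ Ioc 0 rs ∧ ∀ r ∈ Ioc (rs - d) rs, P.Din n ε τ r < 0} (δ τ)) ∧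
            AntitoneOn δ (Ioi τin) ∧ Tendsto δ atTop (𝓝 0) ∧
            ∃ η > 0, ∀ r ∈ Ioo (rs - η) rs, ∀ᶠ τ in atTop, 0 < P.Din n ε τ r) ∧
        -- (c) if and only if (d), with the same critical rate
        ((∃ δ > 0,
            (∀ r ∈ Ioo (rs - δ) rs, P.xPlus r 0 ≤ P.xMinus r 0) ∧
            P.xMinus rs = P.xPlus rs ∧
            ∀ r ∈ Ioo rs (rs + δ), P.xMinus r 0 < P.xPlus r 0) ↔
          rbar < rs ∧ ∃ δ > 0,
            (∃ τ0 ≥ 0, ∀ r ∈ Ioc (rs - δ) rs, ∀ τ > τ0, 0 < P.Dout n ε τ r) ∧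
            ∀ r ∈ Ioo rs (rs + δ), ∃ τout > 0, ∀ τ > τout, P.Dout n ε τ r < 0) ∧
        -- (d) at an isolated collision rate gives a visible rate-induced tipping
        ((∃ η > 0, ∀ r ∈ Ioo (rs - η) (rs + η), r ≠ rs → P.xMinus r ≠ P.xPlus r) →
          (rbar < rs ∧ ∃ δ > 0,
            (∃ τ0 ≥ 0, ∀ r ∈ Ioc (rs - δ) rs, ∀ τ > τ0, 0 < P.Dout n ε τ r) ∧
            ∀ r ∈ Ioo rs (rs + δ), ∃ τout > 0, ∀ τ > τout, P.Dout n ε τ r < 0) →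
          P.CollideInVisibleTipping rs) := by
  have h := h1.admissible h0 hf
  have hL : FlatAtEnds (n + 1) P.Lam P.lm P.lp :=
    .of_iteratedDeriv hLam h0.tendsto_Lam_atBot h0.tendsto_Lam_atTop hLam_bot hLam_top
  have hgap : ∀ l ∈ Icc P.lm P.lp, d0 < P.Xs l - P.Xu l := fun l hl => by
    have hne : ¬ EqOn P.Xs P.Xu (Icc P.lm P.lp) := fun he =>
      (h.Xu_lt_Xs _ h.lm_mem).ne' (he h.lm_mem)
    have := h1.separated _ _ h0.curve_Xs h1.curve_Xu hne l hl
    rwa [abs_of_pos (sub_pos.2 (h.Xu_lt_Xs l hl))] at this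
  have hεgap : ∀ l ∈ Icc P.lm P.lp, ε < P.Xs l - P.Xu l := fun l hl => by
    linarith [hgap l hl, hε.2, h1.d0_pos]
  have hlim : ∀ r ∈ Ioc 0 rt,
      Tendsto (fun τ => P.Din n ε τ r) atTop (𝓝 (P.xMinus r 0 - P.xPlus r 0)) ∧
      Tendsto (fun τ => P.Dout n ε τ r) atTop (𝓝 (P.xMinus r 0 - P.xPlus r 0)) := fun r hr => by
    obtain ⟨δ, hδ, ha⟩ := hattr r hr
    obtain ⟨δ', hδ', hp⟩ := hrep r hr
    exact RateProblem.tendsto_D h hL hr.1 hε.1 hδ hδ' ha hp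
  obtain ⟨κ, hκ, r1, hr1, hslow⟩ := RateProblem.exists_le_Din h hL hε hgap
  -- Strictness below r1 extends the bound `Din` ≥ κ to r = `rbar` itself, so a collision rate is
  -- strictly larger than `rbar`.
  obtain ⟨rbar, hrbar0, hrbar⟩ : ∃ rbar, 0 < rbar ∧ rbar < min r1 rt :=
    exists_between (lt_min hr1 hrt)
  have hrbar1 : rbar < r1 := hrbar.trans_le (min_le_left _ _)
  have hrbart : rbar < rt := hrbar.trans_le (min_le_right _ _)
  obtain ⟨τ1, hτ1, hbetween⟩ := RateProblem.Din_lt_sub_lt_Dout h hL rt hε.1 hrbar0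
  obtain ⟨τ2, hτ2, hmono⟩ := RateProblem.Din_mono h hL rt hε.1 hεgap hrbar0
  have hDpos : ∀ r ∈ Ioc 0 rbar, ∀ τ ≥ 0, κ ≤ P.Din n ε τ r := fun r hr τ hτ =>
    hslow r ⟨hr.1, hr.2.trans_lt hrbar1⟩ τ hτ
  refine ⟨rbar, ⟨hrbar0, hrbart⟩, fun r hr τ hτ => ?_, fun rs hrs => ?_⟩
  · have := hDpos r ⟨hr.1, hr.2.le⟩ τ hτ
    have := RateProblem.Din_lt_Dout h n hε.1 τ r
    constructor <;> linarith
  have hrs' : rs ∈ Ioc 0 rt := ⟨hrs.1, hrs.2.le⟩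
  -- At a collision `Din` tends to 0, which the bound κ excludes for rates up to `rbar`.
  have hlarge : P.xMinus rs = P.xPlus rs → rbar < rs := fun heq => by
    by_contra! hcon
    have := ge_of_tendsto (hlim rs hrs').1
      ((eventually_ge_atTop 0).mono fun τ hτ => hDpos rs ⟨hrs.1, hcon⟩ τ hτ)
    rw [heq, sub_self] at this
    linarith
  have hdc : (rbar < rs ∧ ∃ δ > 0,
      (∃ τ0 ≥ 0, ∀ r ∈ Ioc (rs - δ) rs, ∀ τ > τ0, 0 < P.Dout n ε τ r) ∧
      ∀ r ∈ Ioo rs (rs + δ), ∃ τout > 0, ∀ τ > τout, P.Dout n ε τ r < 0) →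
      ∃ δ > 0, (∀ r ∈ Ioo (rs - δ) rs, P.xPlus r 0 ≤ P.xMinus r 0) ∧
        P.xMinus rs = P.xPlus rs ∧ ∀ r ∈ Ioo rs (rs + δ), P.xMinus r 0 < P.xPlus r 0 := by
    rintro ⟨hbs, δ, hδ, ⟨τ0, -, hpos⟩, hneg⟩
    have hδ' : 0 < min δ (min (rs - rbar) (rt - rs)) :=
      lt_min hδ (lt_min (by linarith) (by linarith [hrs.2]))
    have e1 : min δ (min (rs - rbar) (rt - rs)) ≤ δ := min_le_left _ _
    have e2 : min δ (min (rs - rbar) (rt - rs)) ≤ rs - rbar :=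
      (min_le_right _ _).trans (min_le_left _ _)
    have e3 : min δ (min (rs - rbar) (rt - rs)) ≤ rt - rs :=
      (min_le_right _ _).trans (min_le_right _ _)
    -- Positivity of `Dout` passes to the limit only as a weak inequality; on the right, `Dout` < 0
    -- at a single large τ gives the strict one through the bracket. Continuity at `rs` then forces
    -- equality.
    have hge : ∀ r ∈ Ioc (rs - min δ (min (rs - rbar) (rt - rs))) rs,
        P.xPlus r 0 ≤ P.xMinus r 0 := fun r hr => sub_nonneg.1 <| by
      refine ge_of_tendsto (hlim r ⟨by linarith [hr.1], hr.2.trans hrs.2.le⟩).2 ?_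
      filter_upwards [eventually_gt_atTop τ0] with τ hτ
      exact (hpos r ⟨by linarith [hr.1], hr.2⟩ τ hτ).le
    have hlt : ∀ r ∈ Ioo rs (rs + min δ (min (rs - rbar) (rt - rs))),
        P.xMinus r 0 < P.xPlus r 0 := fun r hr => by
      obtain ⟨τout, -, ho⟩ := hneg r ⟨hr.1, by linarith [hr.2]⟩
      have h2 := (hbetween r ⟨by linarith [hr.1], by linarith [hr.2]⟩ (max τ1 (τout + 1))
        (le_max_left _ _)).2
      have h3 := ho (max τ1 (τout + 1)) (by linarith [le_max_right τ1 (τout + 1)])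
      linarith
    refine ⟨_, hδ', fun r hr => hge r ⟨hr.1, hr.2.le⟩, ?_, hlt⟩
    exact RateProblem.xMinus_eq_xPlus h hrs.1 (le_antisymm
      (RateProblem.xMinus_le_of_right h hrs.1 hδ' fun r hr => (hlt r hr).le)
      (hge rs ⟨by linarith, le_rfl⟩))
  refine ⟨⟨?_, ?_⟩, ⟨?_, hdc⟩, ?_⟩
  · rintro ⟨heq, η, hη, htr⟩
    have hbs := hlarge heq
    have hgt : ∀ r ∈ Ioo (rs - min η rs) rs, ∀ᶠ τ in atTop, 0 < P.Din n ε τ r := fun r hr => by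
      have hr0 : 0 < r := by linarith [hr.1, min_le_right η rs]
      have := (htr r ⟨by linarith [hr.1, min_le_left η rs], hr.2⟩).lt h hr0
      exact (hlim r ⟨hr0, (hr.2.trans hrs.2).le⟩).1.eventually (lt_mem_nhds (sub_pos.2 this))
    -- At `rs` the gap is zero and the bracket is strict, so `Din` < 0 there, and continuity in r
    -- extends this to an interval.
    have hgreat : ∀ τ > max τ1 τ2, IsGreatest
        {d : ℝ | d ∈ Ioc 0 rs ∧ ∀ r ∈ Ioc (rs - d) rs, P.Din n ε τ r < 0}
        (sSup {d : ℝ | d ∈ Ioc 0 rs ∧ ∀ r ∈ Ioc (rs - d) rs, P.Din n ε τ r < 0}) := by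
      intro τ hτ
      refine RateProblem.isGreatest_csSup_Ioc ?_
      have h2 := (hbetween rs ⟨hbs.le, hrs.2.le⟩ τ ((le_max_left _ _).trans hτ.le)).1
      rw [heq, sub_self] at h2
      obtain ⟨e, he, hball⟩ := Metric.eventually_nhds_iff_ball.1
        (((RateProblem.continuous_Din h hL ε τ).tendsto rs).eventually (gt_mem_nhds h2))
      refine ⟨min e rs, ⟨lt_min he hrs.1, min_le_right _ _⟩, fun r hr => hball r ?_⟩
      rw [Real.ball_eq_Ioo]
      exact ⟨by linarith [hr.1, min_le_left e rs], by linarith [hr.2]⟩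
    refine ⟨hbs, max τ1 τ2, le_max_of_le_left hτ1, _, hgreat, ?_, ?_,
      min η rs, lt_min hη hrs.1, hgt⟩
    · intro τ hτ τ' hτ' hle
      refine (hgreat τ hτ).2 ⟨(hgreat τ' hτ').1.1, fun r hr => ?_⟩
      have h2 := (hgreat τ' hτ').1.2 r hr
      have hr0 : 0 < r := by linarith [hr.1, (hgreat τ' hτ').1.1.2]
      have hτ'0 : 0 ≤ τ' := hτ1.trans ((le_max_left _ _).trans (mem_Ioi.1 hτ').le)
      -- Monotonicity in τ is available only for r ≥ `rbar`; negativity of `Din` rules out smaller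
      -- rates.
      have hrb : rbar ≤ r := by
        by_contra! hc
        linarith [hDpos r ⟨hr0, hc.le⟩ τ' hτ'0]
      exact (hmono r ⟨hrb, hr.2.trans hrs.2.le⟩ τ ((le_max_right _ _).trans (mem_Ioi.1 hτ).le)
        τ' hle).trans_lt h2
    · rw [tendsto_order]
      refine ⟨fun a ha => ?_, fun a ha => ?_⟩
      · filter_upwards [eventually_gt_atTop (max τ1 τ2)] with τ hτ
        exact ha.trans (hgreat τ hτ).1.1.1
      -- A rate r just left of `rs` with `Din` eventually positive cannot lie in (rs - δ, rs], which
      -- forces δ < a.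
      · obtain ⟨r, hr, hr'⟩ := exists_between
          (show max (rs - a) (rs - min η rs) < rs from
            max_lt (by linarith) (by linarith [lt_min hη hrs.1]))
        filter_upwards [eventually_gt_atTop (max τ1 τ2),
          hgt r ⟨(le_max_right _ _).trans_lt hr, hr'⟩] with τ hτ hpos
        by_contra! hc
        have := (hgreat τ hτ).1.2 r
          ⟨by linarith [le_max_left (rs - a) (rs - min η rs)], hr'.le⟩
        linarith
  · rintro ⟨hbs, τin, -, δ, hgreat, -, -, η, hη, hev⟩
    have hle : P.xMinus rs 0 ≤ P.xPlus rs 0 := sub_nonpos.1 <| by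
      refine le_of_tendsto (hlim rs hrs').1 ?_
      filter_upwards [eventually_gt_atTop τin] with τ hτ
      have := (hgreat τ hτ).1
      exact (this.2 rs ⟨by linarith [this.1.1], le_rfl⟩).le
    have hη' : 0 < min η (rs - rbar) := lt_min hη (by linarith)
    -- One large τ with `Din` > 0 suffices, since `Din` is below the gap there.
    have hlt : ∀ r ∈ Ioo (rs - min η (rs - rbar)) rs, P.xPlus r 0 < P.xMinus r 0 := fun r hr => by
      obtain ⟨τ, hτ, hpos⟩ := ((eventually_ge_atTop τ1).and
        (hev r ⟨by linarith [hr.1, min_le_left η (rs - rbar)], hr.2⟩)).exists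
      have := (hbetween r ⟨by linarith [hr.1, min_le_right η (rs - rbar)],
        (hr.2.trans hrs.2).le⟩ τ hτ).1
      linarith
    have heq := RateProblem.xMinus_eq_xPlus h hrs.1 (le_antisymm hle
      (RateProblem.xPlus_le_of_left h hrs.1 hη' fun r hr => (hlt r hr).le))
    obtain ⟨e, he, htr⟩ := RateProblem.exists_endPointTracks h hrs.1 heq
    refine ⟨heq, min e (min η (rs - rbar)), lt_min he hη', fun r hr => ?_⟩
    have e1 := min_le_left e (min η (rs - rbar))
    have e2 := min_le_right e (min η (rs - rbar))
    exact htr r ⟨by linarith [hr.1], by linarith [hr.2]⟩ (hlt r ⟨by linarith [hr.1], hr.2⟩)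
  · rintro ⟨δ, hδ, hge, heq, hlt⟩
    have hbs := hlarge heq
    have e1 : min δ (min (rs - rbar) (rt - rs)) ≤ δ := min_le_left _ _
    have e2 : min δ (min (rs - rbar) (rt - rs)) ≤ rs - rbar :=
      (min_le_right _ _).trans (min_le_left _ _)
    have e3 : min δ (min (rs - rbar) (rt - rs)) ≤ rt - rs :=
      (min_le_right _ _).trans (min_le_right _ _)
    refine ⟨hbs, min δ (min (rs - rbar) (rt - rs)),
      lt_min hδ (lt_min (by linarith) (by linarith [hrs.2])), ⟨τ1, hτ1, fun r hr τ hτ => ?_⟩,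
      fun r hr => ?_⟩
    · have h2 := (hbetween r ⟨by linarith [hr.1], hr.2.trans hrs.2.le⟩ τ (le_of_lt hτ)).2
      have h3 : P.xPlus r 0 ≤ P.xMinus r 0 := by
        rcases hr.2.lt_or_eq with hlt' | rfl
        · exact hge r ⟨by linarith [hr.1], hlt'⟩
        · rw [heq]
      linarith
    · have h2 := hlt r ⟨hr.1, by linarith [hr.2]⟩
      obtain ⟨τ0, h3⟩ := eventually_atTop.1
        ((hlim r ⟨hrs.1.trans hr.1, by linarith [hr.2]⟩).2.eventually
          (gt_mem_nhds (sub_neg.2 h2)))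
      exact ⟨max τ0 1, by positivity, fun τ hτ => h3 τ ((le_max_left _ _).trans (le_of_lt hτ))⟩
  · rintro ⟨η, hη, hne⟩ hd
    obtain ⟨δ, hδ, hge, heq, hlt⟩ := hdc hd
    obtain ⟨e, he, htr⟩ := RateProblem.exists_endPointTracks h hrs.1 heq
    have e1 : min (min δ η) (min e rs) ≤ δ := (min_le_left _ _).trans (min_le_left _ _)
    have e2 : min (min δ η) (min e rs) ≤ η := (min_le_left _ _).trans (min_le_right _ _)
    have e3 : min (min δ η) (min e rs) ≤ e := (min_le_right _ _).trans (min_le_left _ _)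
    have e4 : min (min δ η) (min e rs) ≤ rs := (min_le_right _ _).trans (min_le_right _ _)
    refine ⟨min (min δ η) (min e rs), lt_min (lt_min hδ hη) (lt_min he hrs.1), fun r hr => ?_,
      heq, fun r hr => ?_⟩
    · have hr0 : 0 < r := by linarith [hr.1]
      -- Isolation of the collision rate upgrades the weak inequality to a strict one.
      have hlt' : P.xPlus r 0 < P.xMinus r 0 := by
        refine lt_of_le_of_ne (hge r ⟨by linarith [hr.1], hr.2⟩) fun hc => ?_
        exact hne r ⟨by linarith [hr.1], by linarith [hr.2]⟩ hr.2.ne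
          (RateProblem.xMinus_eq_xPlus h hr0 hc.symm)
      exact ⟨htr r ⟨by linarith [hr.1], by linarith [hr.2]⟩ hlt',
        (RateProblem.isSolution_xPlus h hr0).lt h (RateProblem.isSolution_xMinus h hr0) hlt'⟩
    · have hr0 : 0 < r := hrs.1.trans hr.1
      exact (RateProblem.isSolution_xMinus h hr0).lt h (RateProblem.isSolution_xPlus h hr0)
        (hlt r ⟨hr.1, by linarith [hr.2]⟩)
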